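/- **Notation.** For an integer partition $\lambda$ with parts $\lambda_1\ge\lambda_2\ge\cdots\ge\lambda_\ell>0$ (and $\lambda_i=0$ for $i>\ell$), let $|\lambda|=\sum_i\lambda_i$ and $\ell(\lambda)=\ell$; $(0)$ denotes the zero (empty) partition. In words, $i^c$ means $c$ copies of the letter $i$. For a word $A$, $A^+$ is obtained by adding $1$ to every letter. A *quasi-Dyck vector* (QDV) is a word $v=v_1v_2\cdots v_n$ ($n\ge1$) of integers with $v_1=0$ and $v_{i+1}\le v_i+1$ for $1\le i<n$. A *Dyck class* $[v]$ is an equivalence class of QDVs for the equivalence relation generated by $v\sim 0v^+$. The map sending $\lambda$ to the class of $(0-\lambda_n,\,1-\lambda_{n-1},\dots,\,n-1-\lambda_1)$, for any $n>\ell(\lambda)$, is a bijection from integer partitions to Dyck classes; it is used to identify the two. Let $\mathrm{mind}(\lambda)$ be the least $n>\ell(\lambda)$ such that the Ferrers diagram of $\lambda$ fits in that of $(n-1,n-2,\dots,1,0)$. **The map $\mathrm{ND}$.** Let $C_1$ be the set of nonzero partitions $\gamma$ with $\gamma_1\ge\ell=\ell(\gamma)$, and put $\mathrm{ND}_1(\gamma)=(\gamma_2+1,\dots,\gamma_\ell+1,1^{\gamma_1-\ell})$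 for $\gamma\in C_1$. Let $\mathrm{NU}_2$ be the injective map on Dyck classes given by the rules * $\mathrm{NU}_2([0\,1\,2^hA(-1)^{h-1}])=[0\,0^{h-1}\,1\,A\,1^h]$, where $h\ge2$ and $A=A_1\cdots A_s$ is empty, or all $A_i\le2$, $A_s\ge0$ and $A_{i+1}\le A_i+1$ for all $i<s$; * $\mathrm{NU}_2([0\,1\,2^kB(-1)^k])=[0\,0^kB\,0\,1^k]$, where $k\ge1$ and $B=B_1\cdots B_s$ is empty, or all $B_i\le2$, $B_1\le1$, $B_s\ge-1$ and $B_{i+1}\le B_i+1$ for all $i<s$. Its image $C_2$ is disjoint from $C_1$. Let $\mathrm{ND}$ be the map with domain $C_1\cup C_2$ equal to $\mathrm{ND}_1$ on $C_1$ and to the inverse of $\mathrm{NU}_2$ on $C_2$. **Tail initiators.** For a nonzero partition $\lambda$ with largest part $r$ and with $n_i$ parts equal to $i$, let $B_\lambda=01^{n_1}01^{n_2}\cdots01^{n_r}$; let $B_{(0)}$ be the empty word. Let $\mathrm{TI}(\mu)=[0B_\mu]$, and let $\mathrm{TI}_2(\mu)$ be the Dyck class obtained from $\mathrm{TI}(\mu)$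 by applying $\mathrm{ND}$ as many times as possible (this stops, since $\mathrm{ND}$ decreases the size of the partition by $1$). A *flagpole partition* is a partition $\mu$ with $|\mu|+8\le2\,\mathrm{mind}(\mathrm{TI}_2(\mu))$. For a partition $\lambda$ let $a_0(\lambda)=|\lambda|-\lambda_1-\ell(\lambda)+3$ (which is at least $2$), and for integers $a\ge2$ let $v(\lambda,a,0)=0012^aB_\lambda^+$ and $v(\lambda,a,1)=0012^{a-1}B_\lambda^+1$. **Theorem.** An integer partition $\mu$ is a flagpole partition if and only if there exist a partition $\lambda$ and an integer $a\ge a_0(\lambda)$ such that $\mathrm{TI}_2(\mu)=[v(\lambda,a,0)]$ or $\mathrm{TI}_2(\mu)=[v(\lambda,a,1)]$. -/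

import Mathlib

/-! Integer partitions are represented by Mathlib's `YoungDiagram` (the Ferrers diagram, in English
notation): `lam.card` is `|lam|`, `lam.rowLen i` is the part `lam_{i+1}` (and `0` beyond the last
part), `lam.rowLens` is the list of positive parts in weakly decreasing order, and `lam.colLen 0`
is the number `ℓ(lam)` of positive parts. -/

namespace Flagpole

/-! ### Quasi-Dyck vectors and Dyck classes -/

/-- `v = v_1 ⋯ v_n` is a quasi-Dyck vector: `v_1 = 0` (so `n ≥ 1`) and `v_{i+1} ≤ v_i + 1`. -/
def IsQDV (v : List ℤ) : Prop :=
  v.head? = some 0 ∧ v.IsChain (fun a b => b ≤ a + 1)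

/-- The type of quasi-Dyck vectors. -/
abbrev QDV : Type := {v : List ℤ // IsQDV v}

theorem IsQDV.shift {v : List ℤ} (hv : IsQDV v) : IsQDV (0 :: v.map (· + 1)) := by
  obtain ⟨h0, hc⟩ := hv
  refine ⟨rfl, ?_⟩
  rw [List.isChain_cons]
  refine ⟨?_, ?_⟩
  · intro y hy
    cases v with
    | nil => simp at h0
    | cons a l => simp at h0 hy; omega
  · rw [List.isChain_map]
    exact hc.imp (fun a b h => by omega)

/-- The quasi-Dyck vector `0 v^+ = 0 (v_1 + 1) ⋯ (v_n + 1)`. -/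
def QDV.shift (v : QDV) : QDV := ⟨0 :: v.1.map (· + 1), v.2.shift⟩

/-- Dyck classes: the classes of quasi-Dyck vectors for the equivalence relation generated by
`v ∼ 0 v^+`. -/
def DyckClass : Type := Quot (fun v w : QDV => w = v.shift)

/-- The Dyck class `[v]` of a quasi-Dyck vector `v`. -/
def dyckClass (v : List ℤ) (hv : IsQDV v) : DyckClass := Quot.mk _ ⟨v, hv⟩

/-! ### The bijection between partitions and Dyck classes -/

/-- `QDV_n(lam) = (0 - lam_n, 1 - lam_{n-1}, …, n - 1 - lam_1)`. -/
def qdv (n : ℕ) (lam : YoungDiagram) : List ℤ :=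
  (List.range n).map (fun j : ℕ => (j : ℤ) - (lam.rowLen (n - 1 - j) : ℤ))

theorem rowLen_eq_zero_iff (lam : YoungDiagram) (i : ℕ) :
    lam.rowLen i = 0 ↔ lam.colLen 0 ≤ i := by
  have h1 := lam.mem_iff_lt_rowLen (i := i) (j := 0)
  have h2 := lam.mem_iff_lt_colLen (i := i) (j := 0)
  rw [h1] at h2
  omega

theorem isQDV_qdv {n : ℕ} {lam : YoungDiagram} (h : lam.colLen 0 < n) : IsQDV (qdv n lam) := by
  refine ⟨?_, ?_⟩
  · obtain ⟨m, rfl⟩ : ∃ m, n = m + 1 := ⟨n - 1, by omega⟩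
    have := (rowLen_eq_zero_iff lam m).2 (by omega)
    simp [qdv, List.range_succ_eq_map, this]
  · rw [List.isChain_iff_getElem]
    intro i hi
    have := lam.rowLen_anti (n - 1 - (i + 1)) (n - 1 - i) (by omega)
    simp only [qdv, List.getElem_map, List.getElem_range]
    push_cast
    omega

theorem qdv_succ {n : ℕ} {lam : YoungDiagram} (h : lam.colLen 0 < n) :
    qdv (n + 1) lam = 0 :: (qdv n lam).map (· + 1) := by
  have h0 := (rowLen_eq_zero_iff lam n).2 (by omega)
  unfold qdv
  rw [List.range_succ_eq_map]
  simp only [List.map_cons, List.map_map, Nat.add_sub_cancel, Nat.sub_zero, h0]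
  congr 1
  apply List.map_congr_left
  intro j hj
  simp only [Function.comp]
  rw [show n - j.succ = n - 1 - j by omega]
  push_cast
  ring

/-- The Dyck class of a partition, `{QDV_n(lam) : n > ℓ(lam)}`. -/
def classOfPartition (lam : YoungDiagram) : DyckClass :=
  dyckClass (qdv (lam.colLen 0 + 1) lam) (isQDV_qdv (Nat.lt_succ_self _))

theorem dyckClass_qdv {n : ℕ} {lam : YoungDiagram} (h : lam.colLen 0 < n) :
    dyckClass (qdv n lam) (isQDV_qdv h) = classOfPartition lam := by
  induction n with
  | zero => omega
  | succ n ih =>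
    rcases Nat.lt_or_ge (lam.colLen 0) n with h' | h'
    · rw [← ih h']
      symm
      apply Quot.sound
      exact Subtype.ext (qdv_succ h')
    · obtain rfl : n = lam.colLen 0 := by omega
      rfl

/-- The parts `(n - 1 - v_n, …, 1 - v_2, 0 - v_1)` of the partition of a quasi-Dyck vector
(trailing zeros are allowed). -/
def partsOfQDV (v : List ℤ) : List ℕ := (v.mapIdx (fun j x => ((j : ℤ) - x).toNat)).reverse

theorem length_partsOfQDV (v : List ℤ) : (partsOfQDV v).length = v.length := by
  simp [partsOfQDV]

theorem IsQDV.getElem_succ_le {v : List ℤ} (hv : IsQDV v) {j : ℕ} (hj : j + 1 < v.length) :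
    v[j + 1] ≤ v[j] + 1 := (List.isChain_iff_getElem.1 hv.2) j hj

theorem IsQDV.length_pos {v : List ℤ} (hv : IsQDV v) : 0 < v.length := by
  cases v with
  | nil => simp [IsQDV] at hv
  | cons a l => simp

theorem IsQDV.getElem_zero {v : List ℤ} (hv : IsQDV v) : v[0]'hv.length_pos = 0 := by
  cases v with
  | nil => simp [IsQDV] at hv
  | cons a l => simpa using hv.1

theorem IsQDV.getElem_le {v : List ℤ} (hv : IsQDV v) {j : ℕ} (hj : j < v.length) :
    v[j] ≤ j := by
  induction j with
  | zero => rw [hv.getElem_zero]; simp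
  | succ j ih =>
    have := hv.getElem_succ_le hj
    have := ih (by omega)
    push_cast
    omega

theorem sortedGE_partsOfQDV {v : List ℤ} (hv : IsQDV v) : (partsOfQDV v).SortedGE := by
  rw [List.sortedGE_iff_isChain, List.isChain_iff_getElem]
  intro i hi
  have hl := length_partsOfQDV v
  simp only [partsOfQDV, List.getElem_reverse, List.getElem_mapIdx, List.length_mapIdx]
  obtain ⟨k, hk⟩ : ∃ k, v.length - 1 - i = k + 1 := ⟨v.length - 1 - i - 1, by omega⟩
  have hk' : v.length - 1 - (i + 1) = k := by omega
  have := hv.getElem_succ_le (j := k) (by omega)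
  simp only [hk, hk']
  push_cast
  omega

/-- The partition of a quasi-Dyck vector of length `n`:
`lam_1 = n - 1 - v_n`, `lam_2 = n - 2 - v_{n-1}`, and so on. -/
def partitionOfQDV (v : QDV) : YoungDiagram :=
  YoungDiagram.ofRowLens (partsOfQDV v.1) (sortedGE_partsOfQDV v.2)

theorem ofRowLens_append_zero {w : List ℕ} (hw : w.SortedGE) (hw' : (w ++ [0]).SortedGE) :
    YoungDiagram.ofRowLens (w ++ [0]) hw' = YoungDiagram.ofRowLens w hw := by
  ext ⟨i, j⟩
  simp only [YoungDiagram.mem_cells, YoungDiagram.mem_ofRowLens, List.length_append,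
    List.length_singleton]
  constructor
  · rintro ⟨h, h'⟩
    rcases Nat.lt_or_ge i w.length with hi | hi
    · exact ⟨hi, by simpa [List.getElem_append_left hi] using h'⟩
    · simp [List.getElem_append_right hi] at h'
  · rintro ⟨h, h'⟩
    exact ⟨by omega, by simpa [List.getElem_append_left h] using h'⟩

theorem partsOfQDV_shift (v : List ℤ) :
    partsOfQDV (0 :: v.map (· + 1)) = partsOfQDV v ++ [0] := by
  unfold partsOfQDV
  rw [List.mapIdx_cons, List.reverse_cons]
  congr 1
  · congr 1
    apply List.ext_getElem
    · simp
    · intro i h1 h2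
      simp

theorem partitionOfQDV_shift (v : QDV) : partitionOfQDV v.shift = partitionOfQDV v := by
  have h := partsOfQDV_shift v.1
  unfold partitionOfQDV QDV.shift
  simp only [h]
  exact ofRowLens_append_zero _ _

/-- The partition of a Dyck class. -/
def partitionOfClass : DyckClass → YoungDiagram :=
  Quot.lift partitionOfQDV (fun v w h => by rw [h, partitionOfQDV_shift])

theorem rowLen_partitionOfQDV_of_ge (v : QDV) {i : ℕ} (hi : v.1.length ≤ i) :
    (partitionOfQDV v).rowLen i = 0 := by
  by_contra h
  have h1 : (i, 0) ∈ partitionOfQDV v := YoungDiagram.mem_iff_lt_rowLen.2 (by omega)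
  obtain ⟨h2, -⟩ := YoungDiagram.mem_ofRowLens.1 h1
  rw [length_partsOfQDV] at h2
  simp at h2
  omega

theorem rowLen_partitionOfQDV (v : QDV) {j : ℕ} (hj : j < v.1.length) :
    ((partitionOfQDV v).rowLen (v.1.length - 1 - j) : ℤ) = j - v.1[j] := by
  have hl := length_partsOfQDV v.1
  have h := YoungDiagram.rowLen_ofRowLens (hw := sortedGE_partsOfQDV v.2)
    ⟨v.1.length - 1 - j, by omega⟩
  have h' : (partitionOfQDV v).rowLen (v.1.length - 1 - j)
    = (partsOfQDV v.1)[v.1.length - 1 - j]'(by omega) := h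
  rw [h']
  have hk : v.1.length - 1 - (v.1.length - 1 - j) = j := by omega
  simp only [partsOfQDV, List.getElem_reverse, List.getElem_mapIdx, List.length_mapIdx, hk]
  have := v.2.getElem_le hj
  omega

theorem colLen_partitionOfQDV_lt (v : QDV) : (partitionOfQDV v).colLen 0 < v.1.length := by
  have h := rowLen_partitionOfQDV v v.2.length_pos
  rw [v.2.getElem_zero] at h
  have h' : (partitionOfQDV v).rowLen (v.1.length - 1 - 0) = 0 := by omega
  rw [rowLen_eq_zero_iff] at h'
  have := v.2.length_pos
  omega

theorem qdv_partitionOfQDV (v : QDV) : qdv v.1.length (partitionOfQDV v) = v.1 := by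
  apply List.ext_getElem
  · simp [qdv]
  · intro j h1 h2
    have := rowLen_partitionOfQDV v h2
    simp only [qdv, List.getElem_map, List.getElem_range]
    omega

/-- The bijection between integer partitions and Dyck classes that is used to identify them. -/
def dyckEquiv : YoungDiagram ≃ DyckClass where
  toFun := classOfPartition
  invFun := partitionOfClass
  left_inv lam := by
    have hq : IsQDV (qdv (lam.colLen 0 + 1) lam) := isQDV_qdv (Nat.lt_succ_self _)
    change partitionOfQDV ⟨_, hq⟩ = lam
    have hlen : (qdv (lam.colLen 0 + 1) lam).length = lam.colLen 0 + 1 := by simp [qdv]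
    have key : ∀ i, (partitionOfQDV ⟨_, hq⟩).rowLen i = lam.rowLen i := by
      intro i
      rcases Nat.lt_or_ge i (lam.colLen 0 + 1) with hi | hi
      · have h := rowLen_partitionOfQDV ⟨_, hq⟩ (j := lam.colLen 0 - i) (by simp only [hlen]; omega)
        simp only [hlen] at h
        rw [show lam.colLen 0 + 1 - 1 - (lam.colLen 0 - i) = i by omega] at h
        simp only [qdv, List.getElem_map, List.getElem_range] at h
        rw [show lam.colLen 0 + 1 - 1 - (lam.colLen 0 - i) = i by omega] at h
        have h' : (partitionOfQDV ⟨_, hq⟩).rowLen i = (lam.rowLen i : ℤ) := by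
          rw [show ((partitionOfQDV ⟨_, hq⟩).rowLen i : ℤ) = _ from h]; ring
        exact_mod_cast h'
      · rw [rowLen_partitionOfQDV_of_ge ⟨_, hq⟩ (by simp only [hlen]; omega),
          (rowLen_eq_zero_iff lam i).2 (by omega)]
    ext ⟨i, j⟩
    rw [YoungDiagram.mem_cells, YoungDiagram.mem_cells, YoungDiagram.mem_iff_lt_rowLen,
      YoungDiagram.mem_iff_lt_rowLen, key]
  right_inv c := by
    induction c using Quot.ind with
    | mk v =>
      change classOfPartition (partitionOfQDV v) = _
      rw [← dyckClass_qdv (colLen_partitionOfQDV_lt v)]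
      unfold dyckClass
      congr 1
      exact Subtype.ext (qdv_partitionOfQDV v)

/-! ### Minimum triangle height -/

/-- The staircase diagram `Δ_n` of the partition `(n - 1, …, 2, 1, 0)`. -/
def staircase (n : ℕ) : YoungDiagram :=
  YoungDiagram.ofRowLens (List.range n).reverse (by
    rw [List.sortedGE_iff_pairwise, List.pairwise_reverse]
    exact List.pairwise_le_range)

/-- `mind(lam)`: the least `n > ℓ(lam)` such that the diagram of `lam` fits inside `Δ_n`. -/
noncomputable def mind (lam : YoungDiagram) : ℕ :=
  sInf {n | lam.colLen 0 < n ∧ lam ≤ staircase n}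

/-- `mind` of a Dyck class is that of the corresponding partition. -/
noncomputable def DyckClass.mind (c : DyckClass) : ℕ := Flagpole.mind (dyckEquiv.symm c)

/-! ### The map `ND` -/

/-- The parts `(γ_2 + 1, …, γ_ℓ + 1, 1^{γ_1 - ℓ})` of `ND_1(γ)`. -/
def nd1Parts (γ : YoungDiagram) : List ℕ :=
  γ.rowLens.tail.map (· + 1) ++ List.replicate (γ.rowLen 0 - γ.colLen 0) 1

theorem sortedGE_nd1Parts (γ : YoungDiagram) : (nd1Parts γ).SortedGE := by
  rw [nd1Parts, List.sortedGE_iff_pairwise, List.pairwise_append]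
  refine ⟨?_, ?_, ?_⟩
  · rw [List.pairwise_map]
    exact (γ.rowLens_sorted.pairwise.tail).imp (fun h => by omega)
  · exact List.pairwise_replicate.2 (Or.inr le_rfl)
  · intro a ha b hb
    obtain ⟨c, -, rfl⟩ := List.mem_map.1 ha
    obtain rfl := List.eq_of_mem_replicate hb
    omega

/-- The map `ND_1(γ) = (γ_2 + 1, …, γ_ℓ + 1, 1^{γ_1 - ℓ})`, for `γ` in the set `C_1`. -/
def nd1 (γ : YoungDiagram) : YoungDiagram :=
  YoungDiagram.ofRowLens (nd1Parts γ) (sortedGE_nd1Parts γ)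

/-- The domain `C_1` of `ND_1`: the nonzero partitions `γ` with `γ_1 ≥ ℓ(γ)`. This is the range
of the map `NU_1(γ) = (ℓ(γ) + 1, γ_1 - 1, …, γ_ℓ - 1)` on `{γ : γ_1 ≤ ℓ(γ) + 2}`. -/
def InC1 (γ : YoungDiagram) : Prop := γ ≠ ⊥ ∧ γ.colLen 0 ≤ γ.rowLen 0

/-- The input word `0 1 2^h A (-1)^{h-1}` of the first rule for `NU_2`. -/
def wordAIn (h : ℕ) (A : List ℤ) : List ℤ :=
  0 :: 1 :: (List.replicate h 2 ++ (A ++ List.replicate (h - 1) (-1)))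

/-- The output word `0 0^{h-1} 1 A 1^h` of the first rule for `NU_2`. -/
def wordAOut (h : ℕ) (A : List ℤ) : List ℤ :=
  0 :: (List.replicate (h - 1) 0 ++ 1 :: (A ++ List.replicate h 1))

/-- The input word `0 1 2^k B (-1)^k` of the second rule for `NU_2`. -/
def wordBIn (k : ℕ) (B : List ℤ) : List ℤ :=
  0 :: 1 :: (List.replicate k 2 ++ (B ++ List.replicate k (-1)))

/-- The output word `0 0^k B 0 1^k` of the second rule for `NU_2`. -/
def wordBOut (k : ℕ) (B : List ℤ) : List ℤ :=
  0 :: (List.replicate k 0 ++ (B ++ 0 :: List.replicate k 1))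

/-- Admissible lists `A = A_1 ⋯ A_s` in the first rule: `A` is empty, or all `A_i ≤ 2`, `A_s ≥ 0`
and `A_{i+1} ≤ A_i + 1`. -/
structure AdmissibleA (A : List ℤ) : Prop where
  le_two : ∀ x ∈ A, x ≤ 2
  last : ∀ x ∈ A.getLast?, 0 ≤ x
  chain : A.IsChain (fun a b => b ≤ a + 1)

/-- Admissible lists `B = B_1 ⋯ B_s` in the second rule: `B` is empty, or all `B_i ≤ 2`,
`B_1 ≤ 1`, `B_s ≥ -1` and `B_{i+1} ≤ B_i + 1`. -/
structure AdmissibleB (B : List ℤ) : Prop where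
  le_two : ∀ x ∈ B, x ≤ 2
  first : ∀ x ∈ B.head?, x ≤ 1
  last : ∀ x ∈ B.getLast?, -1 ≤ x
  chain : B.IsChain (fun a b => b ≤ a + 1)

theorem mem_head?_replicate {n : ℕ} {a x : ℤ} (h : x ∈ (List.replicate n a).head?) : x = a :=
  List.eq_of_mem_replicate (List.mem_of_mem_head? h)

theorem mem_getLast?_replicate {n : ℕ} {a x : ℤ} (h : x ∈ (List.replicate n a).getLast?) :
    x = a :=
  List.eq_of_mem_replicate (List.mem_of_mem_getLast? h)

theorem isChain_replicate (n : ℕ) (a : ℤ) :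
    (List.replicate n a).IsChain (fun a b => b ≤ a + 1) :=
  List.isChain_replicate_of_rel n (by omega)

theorem AdmissibleA.isQDV_in {h : ℕ} (hh : 2 ≤ h) {A : List ℤ} (hA : AdmissibleA A) :
    IsQDV (wordAIn h A) := by
  obtain ⟨m, rfl⟩ : ∃ m, h = m + 1 := ⟨h - 1, by omega⟩
  refine ⟨rfl, ?_⟩
  unfold wordAIn
  rw [List.isChain_cons_cons, List.isChain_cons, List.isChain_append, List.isChain_append]
  refine ⟨by omega, ?_, isChain_replicate _ _, ⟨hA.chain, isChain_replicate _ _, ?_⟩, ?_⟩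
  · intro y hy
    simp [List.replicate_succ] at hy
    omega
  · intro x hx y hy
    have := hA.last x hx
    have := mem_head?_replicate hy
    omega
  · intro x hx y hy
    have hx' := mem_getLast?_replicate hx
    rcases List.mem_append.1 (List.mem_of_mem_head? hy) with hy | hy
    · have := hA.le_two y hy
      omega
    · have := List.eq_of_mem_replicate hy
      omega

theorem AdmissibleA.isQDV_out {h : ℕ} {A : List ℤ} (hA : AdmissibleA A) :
    IsQDV (wordAOut h A) := by
  refine ⟨rfl, ?_⟩
  unfold wordAOut
  rw [List.isChain_cons, List.isChain_append, List.isChain_cons, List.isChain_append]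
  refine ⟨?_, isChain_replicate _ _, ⟨?_, hA.chain, isChain_replicate _ _, ?_⟩, ?_⟩
  · intro y hy
    rw [List.head?_append] at hy
    cases hm : (List.replicate (h - 1) (0 : ℤ)).head? with
    | none => simp [hm] at hy; omega
    | some z =>
      have := mem_head?_replicate (Option.mem_def.2 hm)
      simp [hm] at hy
      omega
  · intro y hy
    rcases List.mem_append.1 (List.mem_of_mem_head? hy) with hy | hy
    · have := hA.le_two y hy
      omega
    · have := List.eq_of_mem_replicate hy
      omega
  · intro x hx y hy
    have := hA.last x hx
    have := mem_head?_replicate hy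
    omega
  · intro x hx y hy
    have hx' := mem_getLast?_replicate hx
    simp at hy
    omega

theorem AdmissibleB.isQDV_in {k : ℕ} (hk : 1 ≤ k) {B : List ℤ} (hB : AdmissibleB B) :
    IsQDV (wordBIn k B) := by
  obtain ⟨m, rfl⟩ : ∃ m, k = m + 1 := ⟨k - 1, by omega⟩
  refine ⟨rfl, ?_⟩
  unfold wordBIn
  rw [List.isChain_cons_cons, List.isChain_cons, List.isChain_append, List.isChain_append]
  refine ⟨by omega, ?_, isChain_replicate _ _, ⟨hB.chain, isChain_replicate _ _, ?_⟩, ?_⟩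
  · intro y hy
    simp [List.replicate_succ] at hy
    omega
  · intro x hx y hy
    have := hB.last x hx
    have := mem_head?_replicate hy
    omega
  · intro x hx y hy
    have hx' := mem_getLast?_replicate hx
    rcases List.mem_append.1 (List.mem_of_mem_head? hy) with hy | hy
    · have := hB.le_two y hy
      omega
    · have := List.eq_of_mem_replicate hy
      omega

theorem AdmissibleB.isQDV_out {k : ℕ} {B : List ℤ} (hB : AdmissibleB B) :
    IsQDV (wordBOut k B) := by
  have hend : ∀ y ∈ (B ++ 0 :: List.replicate k 1).head?, y ≤ 1 := by
    intro y hy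
    cases B with
    | nil => simp at hy; omega
    | cons b B => exact hB.first y (by simpa using hy)
  refine ⟨rfl, ?_⟩
  unfold wordBOut
  rw [← List.cons_append, ← List.replicate_succ, List.isChain_append, List.isChain_append,
    List.isChain_cons]
  refine ⟨isChain_replicate _ _, ⟨hB.chain, ⟨?_, isChain_replicate _ _⟩, ?_⟩, ?_⟩
  · intro y hy
    have := mem_head?_replicate hy
    omega
  · intro x hx y hy
    have := hB.last x hx
    simp at hy
    omega
  · intro x hx y hy
    have := mem_getLast?_replicate hx
    have := hend y hy
    omega

/-- The graph of the map `NU_2 : D_2 → C_2`: `NU2 c d` says that `NU_2` maps `c` to `d`. -/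
inductive NU2 : DyckClass → DyckClass → Prop
  | ruleA (h : ℕ) (hh : 2 ≤ h) (A : List ℤ) (hA : AdmissibleA A) :
      NU2 (dyckClass (wordAIn h A) (hA.isQDV_in hh)) (dyckClass (wordAOut h A) hA.isQDV_out)
  | ruleB (k : ℕ) (hk : 1 ≤ k) (B : List ℤ) (hB : AdmissibleB B) :
      NU2 (dyckClass (wordBIn k B) (hB.isQDV_in hk)) (dyckClass (wordBOut k B) hB.isQDV_out)

/-- A Dyck class has at most one representative starting with `00`. -/
theorem eq_of_dyckClass_eq {v w : List ℤ} (hv : IsQDV v) (hw : IsQDV w)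
    (hv' : v[1]? = some 0) (hw' : w[1]? = some 0) (h : dyckClass v hv = dyckClass w hw) :
    v = w := by
  have hlen : ∀ (u : List ℤ) (hu : IsQDV u), u[1]? = some 0 →
      u.length = (partitionOfQDV ⟨u, hu⟩).colLen 0 + 1 := by
    intro u hu hu'
    obtain ⟨h1, h1'⟩ := List.getElem?_eq_some_iff.1 hu'
    have h2 := rowLen_partitionOfQDV ⟨u, hu⟩ h1
    have h3 := colLen_partitionOfQDV_lt ⟨u, hu⟩
    have h4 := rowLen_eq_zero_iff (partitionOfQDV ⟨u, hu⟩) (u.length - 1 - 1)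
    simp only [h1'] at h2 h3
    omega
  have hp : partitionOfQDV ⟨v, hv⟩ = partitionOfQDV ⟨w, hw⟩ := congrArg partitionOfClass h
  have h1 := qdv_partitionOfQDV ⟨v, hv⟩
  have h2 := qdv_partitionOfQDV ⟨w, hw⟩
  simp only at h1 h2
  rw [← h1, ← h2, hlen v hv hv', hlen w hw hw', hp]

theorem wordAOut_eq {h : ℕ} (hh : 2 ≤ h) (A : List ℤ) :
    wordAOut h A = List.replicate h 0 ++ 1 :: (A ++ List.replicate h 1) := by
  obtain ⟨m, rfl⟩ : ∃ m, h = m + 1 := ⟨h - 1, by omega⟩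
  simp [wordAOut, List.replicate_succ]

theorem wordBOut_eq (k : ℕ) (B : List ℤ) :
    wordBOut k B = List.replicate (k + 1) 0 ++ (B ++ 0 :: List.replicate k 1) := by
  simp [wordBOut, List.replicate_succ]

theorem replicate_append_cons_inj {a b : ℤ} (hab : a ≠ b) {m n : ℕ} {l l' : List ℤ}
    (h : List.replicate m a ++ b :: l = List.replicate n a ++ b :: l') : m = n ∧ l = l' := by
  induction m generalizing n with
  | zero =>
    cases n with
    | zero => simpa using h
    | succ n => simp [List.replicate_succ] at h; exact absurd h.1.symm hab
  | succ m ih =>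
    cases n with
    | zero => simp [List.replicate_succ] at h; exact absurd h.1 hab
    | succ n =>
      simp only [List.replicate_succ, List.cons_append, List.cons.injEq, true_and] at h
      obtain ⟨h1, h2⟩ := ih h
      exact ⟨by omega, h2⟩

theorem wordAOut_ne_wordBOut {h k : ℕ} (hh : 2 ≤ h) (A B : List ℤ) :
    wordAOut h A ≠ wordBOut k B := by
  intro e
  rw [wordAOut_eq hh, wordBOut_eq] at e
  rcases Nat.lt_or_ge h (k + 1) with hk | hk
  · have e1 := congrArg (fun l => l[h]?) e
    rw [List.getElem?_append_right (by simp), List.getElem?_append_left (by simpa using hk)] at e1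
    simp [hk] at e1
  · have e1 := congrArg (fun l => l.reverse[k]?) e
    simp only [List.reverse_append, List.reverse_cons, List.reverse_replicate,
      List.append_assoc] at e1
    rw [List.getElem?_append_left (by simp; omega),
      List.getElem?_append_right (by simp)] at e1
    simp [List.getElem?_replicate] at e1

theorem NU2_injective {c c' d : DyckClass} (h : NU2 c d) (h' : NU2 c' d) : c = c' := by
  have hA0 : ∀ {h : ℕ} (_ : 2 ≤ h) (A : List ℤ), (wordAOut h A)[1]? = some 0 := by
    intro h hh A
    obtain ⟨m, rfl⟩ : ∃ m, h = m + 2 := ⟨h - 2, by omega⟩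
    simp [wordAOut, List.replicate_succ]
  have hB0 : ∀ {k : ℕ} (_ : 1 ≤ k) (B : List ℤ), (wordBOut k B)[1]? = some 0 := by
    intro k hk B
    obtain ⟨m, rfl⟩ : ∃ m, k = m + 1 := ⟨k - 1, by omega⟩
    simp [wordBOut, List.replicate_succ]
  generalize hd : d = d' at h'
  cases h with
  | ruleA h hh A hA =>
    cases h' with
    | ruleA h' hh' A' hA' =>
      have e := eq_of_dyckClass_eq _ _ (hA0 hh A) (hA0 hh' A') hd
      rw [wordAOut_eq hh, wordAOut_eq hh'] at e
      obtain ⟨rfl, e⟩ := replicate_append_cons_inj (by norm_num) e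
      obtain rfl := List.append_cancel_right e
      rfl
    | ruleB k hk B hB =>
      exact absurd (eq_of_dyckClass_eq _ _ (hA0 hh A) (hB0 hk B) hd) (wordAOut_ne_wordBOut hh A B)
  | ruleB k hk B hB =>
    cases h' with
    | ruleA h' hh' A' hA' =>
      exact absurd (eq_of_dyckClass_eq _ _ (hB0 hk B) (hA0 hh' A') hd).symm
        (wordAOut_ne_wordBOut hh' A' B)
    | ruleB k' hk' B' hB' =>
      have e := eq_of_dyckClass_eq _ _ (hB0 hk B) (hB0 hk' B') hd
      have e2 := congrArg List.reverse e
      rw [wordBOut_eq, wordBOut_eq] at e2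
      simp only [List.reverse_append, List.reverse_cons, List.reverse_replicate,
        List.append_assoc, List.singleton_append] at e2
      obtain ⟨rfl, -⟩ := replicate_append_cons_inj (by norm_num) e2
      rw [wordBOut_eq, wordBOut_eq] at e
      obtain rfl := List.append_cancel_right (List.append_cancel_left e)
      rfl

/-- The sets `C_1` and `C_2` are disjoint. -/
theorem not_inC1_of_NU2 {c d : DyckClass} (h : NU2 c d) : ¬ InC1 (dyckEquiv.symm d) := by
  have key : ∀ (v : List ℤ) (hv : IsQDV v), v[1]? = some 0 → v.getLast? = some 1 →
      ¬ InC1 (partitionOfQDV ⟨v, hv⟩) := by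
    rintro v hv h1 h2 ⟨-, h3⟩
    obtain ⟨h1, h1'⟩ := List.getElem?_eq_some_iff.1 h1
    rw [List.getLast?_eq_getElem?] at h2
    obtain ⟨h2, h2'⟩ := List.getElem?_eq_some_iff.1 h2
    have e1 := rowLen_partitionOfQDV ⟨v, hv⟩ h1
    have e2 := rowLen_partitionOfQDV ⟨v, hv⟩ h2
    have e4 := rowLen_eq_zero_iff (partitionOfQDV ⟨v, hv⟩) (v.length - 1 - 1)
    simp only [h1', h2', Nat.sub_self] at e1 e2
    omega
  cases h with
  | ruleA h hh A hA =>
    obtain ⟨m, rfl⟩ : ∃ m, h = m + 2 := ⟨h - 2, by omega⟩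
    refine key _ hA.isQDV_out (by simp [wordAOut, List.replicate_succ]) ?_
    have e : wordAOut (m + 2) A =
        (0 :: (List.replicate (m + 1) 0 ++ 1 :: (A ++ List.replicate (m + 1) 1))) ++ [1] := by
      rw [wordAOut, List.replicate_succ' (n := m + 1)]
      simp
    rw [e, List.getLast?_concat]
  | ruleB k hk B hB =>
    obtain ⟨m, rfl⟩ : ∃ m, k = m + 1 := ⟨k - 1, by omega⟩
    refine key _ hB.isQDV_out (by simp [wordBOut, List.replicate_succ]) ?_
    have e : wordBOut (m + 1) B =
        (0 :: (List.replicate (m + 1) 0 ++ (B ++ 0 :: List.replicate m 1))) ++ [1] := by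
      rw [wordBOut, List.replicate_succ' (n := m) (a := (1 : ℤ))]
      simp
    rw [e, List.getLast?_concat]

open Classical in
/-- The extended next-down map `ND`, as a partial function (`none` where it is not defined): it is
`ND_1` on `C_1` and the inverse of `NU_2` on the range `C_2` of `NU_2`. -/
noncomputable def ND (c : DyckClass) : Option DyckClass :=
  if InC1 (dyckEquiv.symm c) then some (dyckEquiv (nd1 (dyckEquiv.symm c)))
  else if h : ∃ d, NU2 d c then some h.choose
  else none

/-- `ND` inverts `NU_2` on all of `C_2`. -/
theorem ND_eq_some_of_NU2 {c d : DyckClass} (h : NU2 c d) : ND d = some c := by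
  have h' : ∃ c, NU2 c d := ⟨c, h⟩
  rw [ND, if_neg (not_inC1_of_NU2 h), dif_pos h']
  exact congrArg some (NU2_injective h'.choose_spec h)

theorem card_ofRowLens (w : List ℕ) (hw : w.SortedGE) :
    (YoungDiagram.ofRowLens w hw).card = w.sum := by
  have key : ∀ w : List ℕ, (YoungDiagram.cellsOfRowLens w).card = w.sum := by
    intro w
    induction w with
    | nil => rfl
    | cons a w ih =>
      rw [YoungDiagram.cellsOfRowLens, Finset.card_union_of_disjoint]
      · simp [ih]
      · rw [Finset.disjoint_left]
        rintro ⟨i, j⟩ h1 h2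
        simp at h1 h2
        omega
  exact key w

theorem card_eq_sum_rowLens (γ : YoungDiagram) : γ.card = γ.rowLens.sum := by
  conv_lhs => rw [← γ.ofRowLens_to_rowLens_eq_self]
  exact card_ofRowLens _ _

theorem card_nd1_lt {γ : YoungDiagram} (h : InC1 γ) : (nd1 γ).card < γ.card := by
  obtain ⟨h0, h1⟩ := h
  rw [nd1, card_ofRowLens, card_eq_sum_rowLens γ, nd1Parts]
  have hlen := γ.length_rowLens
  have hsum : ∀ l : List ℕ, (l.map (· + 1)).sum = l.sum + l.length := by
    intro l
    induction l with
    | nil => rfl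
    | cons a l ih => simp [ih]; omega
  have hget : ∀ (h : 0 < γ.rowLens.length), γ.rowLens[0] = γ.rowLen 0 :=
    fun h => YoungDiagram.get_rowLens
  cases hl : γ.rowLens with
  | nil =>
    exfalso
    apply h0
    have hc : γ.card = 0 := by rw [card_eq_sum_rowLens, hl]; rfl
    ext x
    have : γ.cells = ∅ := Finset.card_eq_zero.1 hc
    simp [this]
  | cons a l =>
    simp only [hl, List.length_cons, List.getElem_cons_zero] at hlen hget
    have := hget (by omega)
    simp only [List.tail_cons, List.sum_append, hsum, List.sum_replicate, List.sum_cons,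
      smul_eq_mul]
    omega

theorem sum_mapIdx_toNat (v : List ℤ) (f : ℕ → ℤ) (h : ∀ j (hj : j < v.length), v[j] ≤ f j) :
    ((v.mapIdx (fun j x => (f j - x).toNat)).sum : ℤ) + v.sum
      = ∑ j ∈ Finset.range v.length, f j := by
  induction v generalizing f with
  | nil => simp
  | cons a v ih =>
    have h0 := h 0 (by simp)
    have := ih (fun j => f (j + 1)) (fun j hj => h (j + 1) (by simpa using hj))
    simp only [List.mapIdx_cons, List.sum_cons, List.length_cons, Finset.sum_range_succ']
    simp only [List.getElem_cons_zero] at h0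
    rw [← this, Nat.cast_add, Int.toNat_of_nonneg (by omega)]
    ring

theorem card_add_area (v : QDV) :
    ((partitionOfQDV v).card : ℤ) + v.1.sum = ∑ j ∈ Finset.range v.1.length, (j : ℤ) := by
  rw [partitionOfQDV, card_ofRowLens, partsOfQDV, List.sum_reverse]
  exact sum_mapIdx_toNat v.1 (fun j => (j : ℤ)) (fun j hj => v.2.getElem_le hj)

theorem card_lt_of_NU2 {c d : DyckClass} (h : NU2 c d) :
    (dyckEquiv.symm c).card < (dyckEquiv.symm d).card := by
  have key : ∀ v w : QDV, v.1.length = w.1.length → v.1.sum = w.1.sum + 1 →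
      (partitionOfQDV v).card < (partitionOfQDV w).card := by
    intro v w hl hs
    have h1 := card_add_area v
    have h2 := card_add_area w
    rw [hl] at h1
    omega
  cases h with
  | ruleA h hh A hA =>
    obtain ⟨m, rfl⟩ : ∃ m, h = m + 1 := ⟨h - 1, by omega⟩
    apply key
    · simp [wordAIn, wordAOut]; omega
    · simp [wordAIn, wordAOut]; ring
  | ruleB k hk B hB =>
    apply key
    · simp [wordBIn, wordBOut]; omega
    · simp [wordBIn, wordBOut]; ring

theorem card_lt_of_ND {c d : DyckClass} (h : ND c = some d) :
    (dyckEquiv.symm d).card < (dyckEquiv.symm c).card := by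
  unfold ND at h
  split_ifs at h with h1 h2
  · obtain rfl := Option.some.inj h
    rw [Equiv.symm_apply_apply]
    exact card_nd1_lt h1
  · obtain rfl := Option.some.inj h
    exact card_lt_of_NU2 h2.choose_spec

/-- Iterate `ND`, starting at `c`, as many times as possible. -/
noncomputable def iterateND (c : DyckClass) : DyckClass :=
  match h : ND c with
  | none => c
  | some d => iterateND d
termination_by (dyckEquiv.symm c).card
decreasing_by exact card_lt_of_ND h

/-! ### Tail initiators and flagpole partitions -/

/-- `B_lam = 0 1^{n_1} 0 1^{n_2} ⋯ 0 1^{n_r}`, where `r = lam_1` and `n_i` is the number of parts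
of `lam` equal to `i`; it is the empty word for the zero partition. -/
def wordB (lam : YoungDiagram) : List ℤ :=
  (List.range (lam.rowLen 0)).flatMap
    (fun i => 0 :: List.replicate (lam.rowLens.count (i + 1)) 1)

theorem mem_wordB {lam : YoungDiagram} {x : ℤ} (h : x ∈ wordB lam) : x = 0 ∨ x = 1 := by
  obtain ⟨i, -, hx⟩ := List.mem_flatMap.1 h
  rcases List.mem_cons.1 hx with hx | hx
  · exact Or.inl hx
  · exact Or.inr (List.eq_of_mem_replicate hx)

theorem isChain_of_two {l : List ℤ} (a : ℤ) (h : ∀ x ∈ l, x = a ∨ x = a + 1) :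
    l.IsChain (fun a b => b ≤ a + 1) := by
  refine (List.pairwise_of_forall_mem_list ?_).isChain
  intro x hx y hy
  have := h x hx
  have := h y hy
  omega

theorem isQDV_TI (mu : YoungDiagram) : IsQDV (0 :: wordB mu) := by
  refine ⟨rfl, isChain_of_two 0 ?_⟩
  intro x hx
  rcases List.mem_cons.1 hx with hx | hx
  · exact Or.inl hx
  · simpa using mem_wordB hx

/-- The tail initiator `TI(mu) = [0 B_mu]`. -/
def TI (mu : YoungDiagram) : DyckClass := dyckClass (0 :: wordB mu) (isQDV_TI mu)

/-- The second-order tail initiator `TI_2(mu)`. -/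
noncomputable def TI2 (mu : YoungDiagram) : DyckClass := iterateND (TI mu)

/-- Flagpole partitions. -/
def IsFlagpole (mu : YoungDiagram) : Prop := mu.card + 8 ≤ 2 * (TI2 mu).mind

/-- `a_0(lam) = |lam| - lam_1 - ℓ(lam) + 3`. -/
def a0 (lam : YoungDiagram) : ℤ := lam.card - lam.rowLen 0 - lam.colLen 0 + 3

/-- The word `v(lam, a, 0) = 0 0 1 2^a B_lam^+`. -/
def flagWord0 (lam : YoungDiagram) (a : ℕ) : List ℤ :=
  0 :: 0 :: 1 :: (List.replicate a 2 ++ (wordB lam).map (· + 1))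

/-- The word `v(lam, a, 1) = 0 0 1 2^{a-1} B_lam^+ 1` (used for `a ≥ 2` only). -/
def flagWord1 (lam : YoungDiagram) (a : ℕ) : List ℤ :=
  0 :: 0 :: 1 :: (List.replicate (a - 1) 2 ++ (wordB lam).map (· + 1) ++ [1])

theorem isQDV_flagWord0 (lam : YoungDiagram) (a : ℕ) : IsQDV (flagWord0 lam a) := by
  refine ⟨rfl, ?_⟩
  unfold flagWord0
  rw [List.isChain_cons_cons, List.isChain_cons_cons]
  refine ⟨by omega, by omega, isChain_of_two 1 ?_⟩
  intro x hx
  simp only [List.mem_cons, List.mem_append, List.mem_map, List.mem_replicate] at hx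
  rcases hx with hx | hx | ⟨y, hy, rfl⟩
  · omega
  · omega
  · have := mem_wordB hy
    omega

theorem isQDV_flagWord1 (lam : YoungDiagram) (a : ℕ) : IsQDV (flagWord1 lam a) := by
  refine ⟨rfl, ?_⟩
  unfold flagWord1
  rw [List.isChain_cons_cons, List.isChain_cons_cons]
  refine ⟨by omega, by omega, isChain_of_two 1 ?_⟩
  intro x hx
  simp only [List.mem_cons, List.mem_append, List.mem_map, List.mem_replicate,
    List.not_mem_nil, or_false] at hx
  rcases hx with hx | (hx | ⟨y, hy, rfl⟩) | hx
  · omega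
  · omega
  · have := mem_wordB hy
    omega
  · omega

end Flagpole

/-! The invariant behind the theorem is the deficit of a Dyck class, its size minus its dinv. On a
word it counts the pairs i < j with v_i - v_j not in {0, 1} (bad pairs), minus a weight for each
letter; the weights make the count independent of the representative (`deficit_shift`). `ND`
preserves the deficit: `ND_1` and `NU_2` carry letters from one end of a word to the other, and by
`nd_rotate` a final y that becomes an initial y + 1 keeps its badness with every letter it passes.
The deficit of TI(mu) is |mu|, so mu is flagpole exactly when deficit + 8 ≤ 2 mind holds for the
class TI_2(mu).

For the flag words with parameters lam and a, the deficit is a + 1 + lam_1 + ℓ + |lam| and mind is a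
+ 3 + lam_1 + ℓ, so this inequality says exactly a ≥ a_0(lam). It remains to show that TI_2(mu) is
the class of a flag word whenever the inequality holds.

TI(mu) has a binary representative, and `ND` preserves the weaker property `Balanced`. Let 0A be the
minimal representative of TI_2(mu). The class is outside C_1, so the last letter of A is positive,
and balance confines A to the letters -1, 0, 1, 2. Let W be A if -1 occurs, and A without its
initial 0 otherwise; let n be the length of W. Then mind ≤ n + 2. A few chosen letters of W form bad
pairs with the others, about two for each, so that the deficit is at least 2n - 3 and the inequality
fails (`badPairs_bound_of_neg_one_mem`, `badPairs_bound_of_nonneg`). The exceptions are words in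
C_2, on which `ND` is defined, and words 001w with w in the letters 1, 2. Of the latter, those with
w ending in 11 lie in C_2 and the others are flag words. -/

namespace Flagpole

/-! ### The deficit of a word -/

/-- The indicator of `x - y ∉ {0, 1}`. -/
def nd (x y : ℤ) : ℤ := if x - y = 0 ∨ x - y = 1 then 0 else 1

/-- The weight of a letter in the deficit. -/
def wt (x : ℤ) : ℤ := if x ≤ -2 then x + 2 else if x ≤ 0 then 0 else x

/-- The number of pairs `i < j` with `v_i - v_j ∉ {0, 1}`. -/
def badPairs : List ℤ → ℤ
  | [] => 0
  | x :: l => (l.map (nd x)).sum + badPairs l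

/-- The number of pairs `(i, j)` with `v_i - w_j ∉ {0, 1}`. -/
def cross (v w : List ℤ) : ℤ := (v.map fun x => (w.map (nd x)).sum).sum

/-- The deficit (size minus dinv) of a quasi-Dyck vector. -/
def deficit (v : List ℤ) : ℤ := badPairs v - (v.map wt).sum

theorem nd_nonneg (x y : ℤ) : 0 ≤ nd x y := by unfold nd; split_ifs <;> omega

/-- Both sides test y ∈ {x - 1, x}. Thus a letter y to the right of a block may be exchanged for y +
1 to its left. -/
theorem nd_rotate (x y : ℤ) : nd x y = nd (y + 1) x := by
  unfold nd
  by_cases h : x - y = 0 ∨ x - y = 1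
  · rw [if_pos h, if_pos (by omega)]
  · rw [if_neg h, if_neg (by omega)]

theorem nd_add_right (x y c : ℤ) : nd (x + c) (y + c) = nd x y := by
  unfold nd; rw [show x + c - (y + c) = x - y by ring]

theorem sum_map_nonneg {f : ℤ → ℤ} {l : List ℤ} (h : ∀ x ∈ l, 0 ≤ f x) : 0 ≤ (l.map f).sum := by
  apply List.sum_nonneg
  intro y hy
  obtain ⟨x, hx, rfl⟩ := List.mem_map.1 hy
  exact h x hx

theorem sum_nd_nonneg (x : ℤ) (l : List ℤ) : 0 ≤ (l.map (nd x)).sum :=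
  sum_map_nonneg fun _ _ => nd_nonneg _ _

theorem badPairs_nonneg (l : List ℤ) : 0 ≤ badPairs l := by
  induction l with
  | nil => exact le_rfl
  | cons x l ih => exact add_nonneg (sum_nd_nonneg x l) ih

theorem cross_nil_left (w : List ℤ) : cross [] w = 0 := rfl

theorem cross_cons_left (x : ℤ) (v w : List ℤ) :
    cross (x :: v) w = (w.map (nd x)).sum + cross v w := rfl

theorem cross_nil_right (v : List ℤ) : cross v [] = 0 := by simp [cross]

theorem cross_cons_right (y : ℤ) (v w : List ℤ) :
    cross v (y :: w) = (v.map (nd · y)).sum + cross v w := by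
  simp [cross, List.sum_map_add]

theorem cross_append_right (u v w : List ℤ) : cross u (v ++ w) = cross u v + cross u w := by
  simp [cross, List.sum_map_add]

theorem cross_nonneg (v w : List ℤ) : 0 ≤ cross v w :=
  sum_map_nonneg fun x _ => sum_nd_nonneg x w

theorem cross_replicate_left (n : ℕ) (x : ℤ) (w : List ℤ) :
    cross (List.replicate n x) w = n * (w.map (nd x)).sum := by
  simp [cross]

theorem cross_replicate_right (n : ℕ) (y : ℤ) (v : List ℤ) :
    cross v (List.replicate n y) = n * (v.map (nd · y)).sum := by
  induction n with
  | zero => simp [cross_nil_right]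
  | succ n ih => rw [List.replicate_succ, cross_cons_right, ih]; push_cast; ring

theorem sum_nd_le_cross {v w : List ℤ} {y : ℤ} (hy : y ∈ w) :
    (v.map (nd · y)).sum ≤ cross v w := by
  obtain ⟨s, t, rfl⟩ := List.append_of_mem hy
  rw [cross_append_right, cross_cons_right]
  have := cross_nonneg v s
  have := cross_nonneg v t
  omega

theorem badPairs_append (v w : List ℤ) :
    badPairs (v ++ w) = badPairs v + badPairs w + cross v w := by
  induction v with
  | nil => simp [badPairs, cross_nil_left]
  | cons x v ih =>
    simp only [List.cons_append, badPairs, ih, cross_cons_left, List.map_append, List.sum_append]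
    ring

theorem badPairs_replicate (n : ℕ) (x : ℤ) : badPairs (List.replicate n x) = 0 := by
  induction n with
  | zero => rfl
  | succ n ih => simp [List.replicate_succ, badPairs, ih, nd]

theorem badPairs_map_add (c : ℤ) (v : List ℤ) : badPairs (v.map (· + c)) = badPairs v := by
  induction v with
  | nil => rfl
  | cons x v ih =>
    simp only [List.map_cons, badPairs, ih, List.map_map, Function.comp_def, nd_add_right]

theorem badPairs_map_sub_one (v : List ℤ) : badPairs (v.map (· - 1)) = badPairs v :=
  badPairs_map_add (-1) v

theorem sum_map_eq_of_forall {f g : ℤ → ℤ} (l : List ℤ) (h : ∀ x ∈ l, f x = g x) :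
    (l.map f).sum = (l.map g).sum := by
  rw [List.map_congr_left h]

/-- The weight is chosen so that wt(x + 1) - wt(x) = nd 0 (x + 1): raising a letter gains exactly
the badness of its pair with the new initial 0. -/
theorem deficit_shift (v : List ℤ) : deficit (0 :: v.map (· + 1)) = deficit v := by
  have h : (v.map fun x => nd 0 (x + 1) + wt x).sum = (v.map fun x => wt (x + 1)).sum := by
    apply sum_map_eq_of_forall
    intro x _
    unfold nd wt
    split_ifs <;> omega
  rw [List.sum_map_add] at h
  simp only [deficit, badPairs, badPairs_map_add, List.map_cons, List.map_map, Function.comp_def,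
    List.sum_cons]
  have : wt 0 = 0 := by simp [wt]
  omega

/-- The deficit is invariant under `ND_1`. -/
theorem deficit_rotate (v : List ℤ) : deficit (0 :: (v ++ [0])) = deficit (0 :: v.map (· - 1)) := by
  have h : (v.map fun x => nd 0 x + nd x 0 + wt (x - 1)).sum
      = (v.map fun x => nd 0 (x - 1) + wt x).sum := by
    apply sum_map_eq_of_forall
    intro x _
    unfold nd wt
    split_ifs <;> omega
  simp only [List.sum_map_add] at h
  simp only [deficit, badPairs, badPairs_append, badPairs_map_sub_one, cross_cons_right,
    cross_nil_right, List.map_cons, List.map_map, Function.comp_def, List.sum_cons,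
    List.map_append, List.sum_append, List.map_nil, List.sum_nil]
  have : wt 0 = 0 := by simp [wt]
  have : nd 0 0 = 0 := by simp [nd]
  omega

/-! ### Invariance of the deficit under NU_2 -/

theorem sum_nd_rotate (y : ℤ) (l : List ℤ) :
    (l.map fun x => nd x y).sum = (l.map (nd (y + 1))).sum :=
  sum_map_eq_of_forall l fun x _ => nd_rotate x y

/-- By rotation, the pairs of A with the final 1^h and with the final (-1)^(h-1) agree with its
pairs with an initial 2^h and an initial 0^(h-1). What is left does not involve A and is a
polynomial identity in h. -/
theorem deficit_wordA {h : ℕ} (hh : 2 ≤ h) (A : List ℤ) :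
    deficit (wordAIn h A) = deficit (wordAOut h A) := by
  obtain ⟨m, rfl⟩ : ∃ m, h = m + 1 := ⟨h - 1, by omega⟩
  have e1 := sum_nd_rotate 1 A
  have e2 := sum_nd_rotate (-1) A
  rw [show (1 : ℤ) + 1 = 2 by rfl] at e1
  rw [show (-1 : ℤ) + 1 = 0 by rfl] at e2
  simp only [wordAIn, wordAOut, deficit, badPairs, badPairs_append, badPairs_replicate,
    cross_append_right, cross_cons_right, cross_replicate_left, cross_replicate_right,
    List.map_append, List.sum_append, List.map_cons, List.sum_cons, List.map_replicate,
    List.sum_replicate, Nat.add_sub_cancel, e1, e2]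
  simp only [show nd 0 1 = 1 by rfl, show nd 0 2 = 1 by rfl, show nd 0 (-1) = 0 by rfl,
    show nd 1 2 = 1 by rfl, show nd 1 (-1) = 1 by rfl, show nd 2 (-1) = 1 by rfl,
    show nd 0 0 = 0 by rfl, show nd 1 1 = 0 by rfl, show wt 0 = 0 by rfl,
    show wt 1 = 1 by rfl, show wt 2 = 2 by rfl, show wt (-1) = 0 by rfl, nsmul_eq_mul]
  push_cast
  ring

theorem deficit_wordB (k : ℕ) (B : List ℤ) :
    deficit (wordBIn k B) = deficit (wordBOut k B) := by
  have e0 := sum_nd_rotate 0 B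
  have e1 := sum_nd_rotate 1 B
  have e2 := sum_nd_rotate (-1) B
  rw [show (0 : ℤ) + 1 = 1 by rfl] at e0
  rw [show (1 : ℤ) + 1 = 2 by rfl] at e1
  rw [show (-1 : ℤ) + 1 = 0 by rfl] at e2
  simp only [wordBIn, wordBOut, deficit, badPairs, badPairs_append, badPairs_replicate,
    cross_append_right, cross_cons_right, cross_replicate_left, cross_replicate_right,
    List.map_append, List.sum_append, List.map_cons, List.sum_cons, List.map_replicate,
    List.sum_replicate, e0, e1, e2]
  simp only [show nd 0 1 = 1 by rfl, show nd 0 2 = 1 by rfl, show nd 0 (-1) = 0 by rfl,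
    show nd 1 2 = 1 by rfl, show nd 1 (-1) = 1 by rfl, show nd 2 (-1) = 1 by rfl,
    show nd 0 0 = 0 by rfl, show wt 0 = 0 by rfl,
    show wt 1 = 1 by rfl, show wt 2 = 2 by rfl, show wt (-1) = 0 by rfl, nsmul_eq_mul]
  ring

/-- The deficit of a Dyck class. -/
def DyckClass.deficit : DyckClass → ℤ :=
  Quot.lift (fun v : QDV => Flagpole.deficit v.1)
    (fun v w h => by rw [h]; exact (deficit_shift v.1).symm)

theorem deficit_dyckClass (v : List ℤ) (hv : IsQDV v) : (dyckClass v hv).deficit = deficit v := rfl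

theorem deficit_of_NU2 {c d : DyckClass} (h : NU2 c d) : c.deficit = d.deficit := by
  cases h with
  | ruleA h hh A hA => exact deficit_wordA hh A
  | ruleB k hk B hB => exact deficit_wordB k B

/-! ### Minimal representatives and `ND_1` -/

/-- `A` is empty or `A_1 ≤ 0`: then `0A` is the shortest representative of its Dyck class. -/
def IsMinimal (A : List ℤ) : Prop := ∀ x ∈ A.head?, x ≤ 0

theorem isQDV_zero_cons {A : List ℤ} :
    IsQDV (0 :: A) ↔ (∀ x ∈ A.head?, x ≤ 1) ∧ A.IsChain (fun a b => b ≤ a + 1) := by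
  simp [IsQDV, List.isChain_cons]

/-- A second letter a ≤ 0 corresponds to the part 1 - a > 0, while the initial 0 corresponds to the
part 0. -/
theorem length_eq_of_isMinimal {A : List ℤ} (hA : IsMinimal A) (h : IsQDV (0 :: A)) :
    A.length = (partitionOfQDV ⟨0 :: A, h⟩).colLen 0 := by
  have h3 := colLen_partitionOfQDV_lt ⟨0 :: A, h⟩
  cases A with
  | nil => simp at h3 ⊢; omega
  | cons a A =>
    have ha : a ≤ 0 := hA a (by simp)
    have h2 := rowLen_partitionOfQDV ⟨0 :: a :: A, h⟩ (j := 1) (by simp)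
    have h4 := rowLen_eq_zero_iff (partitionOfQDV ⟨0 :: a :: A, h⟩) A.length
    simp at h2 h3
    simp
    omega

theorem eq_of_isMinimal {A A' : List ℤ} (hA : IsMinimal A) (hA' : IsMinimal A')
    (h : IsQDV (0 :: A)) (h' : IsQDV (0 :: A')) (e : dyckClass _ h = dyckClass _ h') :
    A = A' := by
  have hp : partitionOfQDV ⟨_, h⟩ = partitionOfQDV ⟨_, h'⟩ := congrArg partitionOfClass e
  have h1 := qdv_partitionOfQDV ⟨_, h⟩
  have h2 := qdv_partitionOfQDV ⟨_, h'⟩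
  have h3 := length_eq_of_isMinimal hA h
  have h4 := length_eq_of_isMinimal hA' h'
  rw [hp] at h3 h1
  simp only [List.length_cons, h3] at h1
  simp only [List.length_cons, h4] at h2
  exact (List.cons.inj (h1.symm.trans h2)).2

theorem symm_dyckClass (v : List ℤ) (hv : IsQDV v) :
    dyckEquiv.symm (dyckClass v hv) = partitionOfQDV ⟨v, hv⟩ := rfl

theorem rowLen_zero_partitionOfQDV {A : List ℤ} {x : ℤ} (h : IsQDV (0 :: (A ++ [x]))) :
    ((partitionOfQDV ⟨_, h⟩).rowLen 0 : ℤ) = A.length + 1 - x := by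
  have := rowLen_partitionOfQDV ⟨_, h⟩ (j := A.length + 1) (by simp)
  simp at this
  omega

/-- Here ℓ is the length of A plus 1 and the largest part is that number minus x. -/
theorem inC1_iff_of_isMinimal {A : List ℤ} {x : ℤ} (hA : IsMinimal (A ++ [x]))
    (h : IsQDV (0 :: (A ++ [x]))) :
    InC1 (dyckEquiv.symm (dyckClass _ h)) ↔ x ≤ 0 := by
  rw [symm_dyckClass, InC1]
  have h1 := rowLen_zero_partitionOfQDV h
  have h2 := length_eq_of_isMinimal hA h
  simp only [List.length_append, List.length_singleton] at h2
  constructor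
  · rintro ⟨-, h3⟩
    omega
  · intro hx
    refine ⟨fun h0 => ?_, by omega⟩
    rw [h0] at h2
    have := (rowLen_eq_zero_iff ⊥ 0).1 (by
      by_contra hne
      exact YoungDiagram.notMem_bot (0, 0) (YoungDiagram.mem_iff_lt_rowLen.2 (by omega)))
    omega

theorem eq_bot_of_colLen_zero {γ : YoungDiagram} (h : γ.colLen 0 = 0) : γ = ⊥ := by
  rw [eq_bot_iff]
  rintro ⟨i, j⟩ hx
  exfalso
  have h1 : (i, 0) ∈ γ := γ.up_left_mem le_rfl (Nat.zero_le j) hx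
  have := YoungDiagram.mem_iff_lt_colLen.1 h1
  omega

theorem not_inC1_of_nil (h : IsQDV [0]) : ¬ InC1 (dyckEquiv.symm (dyckClass _ h)) := by
  rintro ⟨h1, -⟩
  apply h1
  apply eq_bot_of_colLen_zero
  rw [symm_dyckClass]
  exact (length_eq_of_isMinimal (A := []) (by simp [IsMinimal]) h).symm

theorem rowLen_ofRowLens_eq_getD (w : List ℕ) (hw : w.SortedGE) (i : ℕ) :
    (YoungDiagram.ofRowLens w hw).rowLen i = w.getD i 0 := by
  rcases Nat.lt_or_ge i w.length with hi | hi
  · rw [List.getD_eq_getElem _ _ hi]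
    exact YoungDiagram.rowLen_ofRowLens (hw := hw) ⟨i, hi⟩
  · rw [List.getD_eq_default _ _ hi]
    by_contra h
    have h1 : (i, 0) ∈ YoungDiagram.ofRowLens w hw :=
      YoungDiagram.mem_iff_lt_rowLen.2 (by omega)
    obtain ⟨h2, -⟩ := YoungDiagram.mem_ofRowLens.1 h1
    simp at h2
    omega

theorem ext_rowLen {γ δ : YoungDiagram} (h : ∀ i, γ.rowLen i = δ.rowLen i) : γ = δ := by
  ext ⟨i, j⟩
  rw [YoungDiagram.mem_cells, YoungDiagram.mem_cells, YoungDiagram.mem_iff_lt_rowLen,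
    YoungDiagram.mem_iff_lt_rowLen, h]

/-- One formula covers both kinds of parts, since the ones added at the end are γ_j + 1 with γ_j =
0; there are γ_1 - 1 parts altogether. -/
theorem rowLen_nd1 {γ : YoungDiagram} (h : γ.colLen 0 ≤ γ.rowLen 0) (i : ℕ) :
    (nd1 γ).rowLen i = if i + 1 < γ.rowLen 0 then γ.rowLen (i + 1) + 1 else 0 := by
  rw [nd1, rowLen_ofRowLens_eq_getD, nd1Parts, List.getD_eq_getElem?_getD, List.getElem?_append]
  have hl := γ.length_rowLens
  have h0 := rowLen_eq_zero_iff γ 0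
  have h1 := rowLen_eq_zero_iff γ (i + 1)
  simp only [List.length_map, List.length_tail, hl]
  split_ifs with h2 h3 h3
  · have h4 : i + 1 < γ.rowLens.length := by omega
    have h5 : γ.rowLens[i + 1] = γ.rowLen (i + 1) := YoungDiagram.get_rowLens
    rw [List.getElem?_map, List.getElem?_tail, List.getElem?_eq_getElem h4, h5]
    rfl
  · omega
  · rw [List.getElem?_replicate, if_pos (by omega), h1.2 (by omega)]
    rfl
  · rw [List.getElem?_replicate, if_neg (by omega)]
    rfl

theorem isQDV_rotate {B : List ℤ} (h : IsQDV (0 :: (B ++ [0]))) :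
    IsQDV (0 :: B.map (· - 1)) := by
  rw [isQDV_zero_cons] at h ⊢
  obtain ⟨h1, h2⟩ := h
  rw [List.isChain_append] at h2
  refine ⟨?_, ?_⟩
  · cases B with
    | nil => simp
    | cons b B => have := h1 b (by simp); simp; omega
  · rw [List.isChain_map]
    exact h2.1.imp fun a b h => by omega

/-- `ND_1` maps the class of `0B0` to the class of `0B^-`. -/
theorem nd1_rotate {B : List ℤ} (h : IsQDV (0 :: (B ++ [0]))) :
    nd1 (partitionOfQDV ⟨_, h⟩) = partitionOfQDV ⟨_, isQDV_rotate h⟩ := by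
  have h0 := rowLen_zero_partitionOfQDV h
  have hc := colLen_partitionOfQDV_lt ⟨_, h⟩
  simp at hc
  apply ext_rowLen
  intro i
  rw [rowLen_nd1 (by omega)]
  split_ifs with hi
  -- Row i + 1 of the first partition and row i of the second are read off the same letter of B. The
  -- index is written as a successor to skip the leading 0.
  · have h1 := rowLen_partitionOfQDV ⟨_, h⟩ (j := B.length - 1 - i + 1) (by simp; omega)
    have h2 := rowLen_partitionOfQDV ⟨_, isQDV_rotate h⟩ (j := B.length - 1 - i + 1)
      (by simp; omega)
    have hb : B.length - 1 - i < B.length := by omega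
    simp only [List.length_cons, List.length_append, List.length_map, List.length_nil,
      List.getElem_cons_succ, List.getElem_append_left hb, List.getElem_map] at h1 h2
    rw [show B.length + (0 + 1) + 1 - 1 - (B.length - 1 - i + 1) = i + 1 by omega] at h1
    rw [show B.length + 1 - 1 - (B.length - 1 - i + 1) = i by omega] at h2
    omega
  · rcases Nat.lt_or_ge B.length i with h3 | h3
    · rw [rowLen_partitionOfQDV_of_ge _ (by simp; omega)]
    · obtain rfl : i = B.length := by omega
      have h2 := rowLen_partitionOfQDV ⟨_, isQDV_rotate h⟩ (j := 0) (by simp)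
      simp at h2
      omega

theorem eq_or_NU2_of_ND {c d : DyckClass} (h : ND c = some d) :
    (InC1 (dyckEquiv.symm c) ∧ d = dyckEquiv (nd1 (dyckEquiv.symm c))) ∨ NU2 d c := by
  unfold ND at h
  split_ifs at h with h1 h2
  · exact Or.inl ⟨h1, (Option.some.inj h).symm⟩
  · obtain rfl := Option.some.inj h
    exact Or.inr h2.choose_spec

theorem ND_rotate {B : List ℤ} (h : IsQDV (0 :: (B ++ [0]))) :
    dyckEquiv (nd1 (dyckEquiv.symm (dyckClass _ h))) = dyckClass _ (isQDV_rotate h) := by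
  rw [symm_dyckClass, nd1_rotate, ← symm_dyckClass, Equiv.apply_symm_apply]

theorem iterateND_induction {P : DyckClass → Prop} (hP : ∀ c d, ND c = some d → P c → P d)
    (c : DyckClass) (hc : P c) : P (iterateND c) ∧ ND (iterateND c) = none := by
  induction hn : (dyckEquiv.symm c).card using Nat.strong_induction_on generalizing c with
  | _ n ih =>
    rw [iterateND]
    split
    · next h => exact ⟨hc, h⟩
    · next d h =>
      exact ih _ (by rw [← hn]; exact card_lt_of_ND h) d (hP c d h hc) rfl

theorem dyckClass_shift {A : List ℤ} (h : IsQDV A) : dyckClass A h = dyckClass _ h.shift :=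
  Quot.sound rfl

/-! ### Balanced classes -/

/-- A condition on the word `A` of a minimal representative `0A` that is stable under `ND`. -/
structure Balanced (A : List ℤ) : Prop where
  isMinimal : IsMinimal A
  range : ∀ x ∈ A, -3 ≤ x ∧ x ≤ 2
  pair : A.Pairwise fun x y => y ≤ x + 2 ∧ x ≤ y + 3

/-- The class has a balanced minimal representative. -/
def DyckClass.IsBalanced (c : DyckClass) : Prop :=
  ∃ (A : List ℤ) (h : IsQDV (0 :: A)), Balanced A ∧ dyckClass _ h = c

/-- Shifting -x times turns the last letter into 0, so that `ND_1` applies as a rotation. For x < 0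
the result is 0 1 ⋯ (-x - 1) followed by A raised by -x - 1; the bounds that tie the letters of A to
x keep it balanced. -/
theorem Balanced.rotate {A : List ℤ} {x : ℤ} (hA : Balanced (A ++ [x])) (hx : x ≤ 0)
    (h : IsQDV (0 :: (A ++ [x]))) :
    ∃ (B : List ℤ) (hB : IsQDV (0 :: (B ++ [0]))), dyckClass _ hB = dyckClass _ h ∧
      Balanced (B.map (· - 1)) := by
  obtain ⟨h1, h2, h3⟩ := hA
  have hx3 := (h2 x (by simp)).1
  rw [List.pairwise_append] at h3
  obtain ⟨h3, -, h4⟩ := h3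
  have h5 : ∀ y ∈ A, x ≤ y + 2 ∧ y ≤ x + 3 := fun y hy => h4 y hy x (by simp)
  have h6 : ∀ y ∈ A, -3 ≤ y ∧ y ≤ 2 := fun y hy => h2 y (by simp [hy])
  have h7 : ∀ y ∈ A.head?, y ≤ 0 := by
    intro y hy
    apply h1
    cases A with
    | nil => simp at hy
    | cons a A => simpa using hy
  have key : ∀ c : ℤ, (A.map (· + c)).Pairwise fun x y => y ≤ x + 2 ∧ x ≤ y + 3 := by
    intro c
    rw [List.pairwise_map]
    exact h3.imp fun h => by omega
  -- The number of shifts needed is 0, 1, 2 or 3.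
  obtain rfl | rfl | rfl | rfl : x = 0 ∨ x = -1 ∨ x = -2 ∨ x = -3 := by omega
  · refine ⟨A, h, rfl, ?_, ?_, key (-1)⟩
    · intro y hy
      simp only [List.head?_map, Option.mem_def, Option.map_eq_some_iff] at hy
      obtain ⟨z, hz, rfl⟩ := hy
      have := h7 z hz
      omega
    · intro y hy
      obtain ⟨z, hz, rfl⟩ := List.mem_map.1 hy
      have := h5 z hz
      have := h6 z hz
      omega
  · have e : 0 :: (0 :: (A ++ [-1])).map (· + 1) = 0 :: ((1 :: A.map (· + 1)) ++ [0]) := by simp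
    refine ⟨1 :: A.map (· + 1), e ▸ h.shift, ?_, ?_⟩
    · rw [dyckClass_shift h]
      simp only [e]
    · have e' : (1 :: A.map (· + 1)).map (· - 1) = 0 :: A.map (· + 0) := by
        simp [Function.comp_def]
      rw [e']
      refine ⟨by simp [IsMinimal], ?_, ?_⟩
      · intro y hy
        simp only [List.mem_cons, List.mem_map] at hy
        obtain rfl | ⟨z, hz, rfl⟩ := hy
        · omega
        · have := h6 z hz; omega
      · rw [List.pairwise_cons]
        refine ⟨?_, key 0⟩
        intro y hy
        obtain ⟨z, hz, rfl⟩ := List.mem_map.1 hy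
        have := h5 z hz
        have := h6 z hz
        omega
  · have e : 0 :: (0 :: (0 :: (A ++ [-2])).map (· + 1)).map (· + 1)
        = 0 :: ((1 :: 2 :: A.map (· + 2)) ++ [0]) := by simp
    refine ⟨1 :: 2 :: A.map (· + 2), e ▸ h.shift.shift, ?_, ?_⟩
    · rw [dyckClass_shift h, dyckClass_shift h.shift]
      simp only [e]
    · have e' : (1 :: 2 :: A.map (· + 2)).map (· - 1) = 0 :: 1 :: A.map (· + 1) := by
        simp [add_sub_assoc]
      rw [e']
      refine ⟨by simp [IsMinimal], ?_, ?_⟩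
      · intro y hy
        simp only [List.mem_cons, List.mem_map] at hy
        obtain rfl | rfl | ⟨z, hz, rfl⟩ := hy
        · omega
        · omega
        · have := h6 z hz; have := h5 z hz; omega
      · rw [List.pairwise_cons, List.pairwise_cons]
        refine ⟨?_, ?_, key 1⟩
        · intro y hy
          simp only [List.mem_cons, List.mem_map] at hy
          obtain rfl | ⟨z, hz, rfl⟩ := hy
          · omega
          · have := h5 z hz
            have := h6 z hz
            omega
        · intro y hy
          obtain ⟨z, hz, rfl⟩ := List.mem_map.1 hy
          have := h5 z hz
          have := h6 z hz
          omega
  · have e : 0 :: (0 :: (0 :: (0 :: (A ++ [-3])).map (· + 1)).map (· + 1)).map (· + 1)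
        = 0 :: ((1 :: 2 :: 3 :: A.map (· + 3)) ++ [0]) := by simp
    refine ⟨1 :: 2 :: 3 :: A.map (· + 3), e ▸ h.shift.shift.shift, ?_, ?_⟩
    · rw [dyckClass_shift h, dyckClass_shift h.shift, dyckClass_shift h.shift.shift]
      simp only [e]
    · have e' : (1 :: 2 :: 3 :: A.map (· + 3)).map (· - 1) = 0 :: 1 :: 2 :: A.map (· + 2) := by
        simp [add_sub_assoc]
      rw [e']
      refine ⟨by simp [IsMinimal], ?_, ?_⟩
      · intro y hy
        simp only [List.mem_cons, List.mem_map] at hy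
        obtain rfl | rfl | rfl | ⟨z, hz, rfl⟩ := hy
        · omega
        · omega
        · omega
        · have := h6 z hz; have := h5 z hz; omega
      · rw [List.pairwise_cons, List.pairwise_cons, List.pairwise_cons]
        refine ⟨?_, ?_, ?_, key 2⟩
        all_goals
          intro y hy
          simp only [List.mem_cons, List.mem_map] at hy
        · obtain rfl | rfl | ⟨z, hz, rfl⟩ := hy
          · omega
          · omega
          · have := h5 z hz
            have := h6 z hz
            omega
        · obtain rfl | ⟨z, hz, rfl⟩ := hy
          · omega
          · have := h5 z hz
            have := h6 z hz
            omega
        · obtain ⟨z, hz, rfl⟩ := hy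
          have := h5 z hz
          have := h6 z hz
          omega

/-- Undoing two shifts of 012T gives the minimal representative 0T^(--). Letters in [-1, 2] land in
[-3, 0], and a final -1 is compatible with all of them. -/
theorem isBalanced_of_NU2_aux {S : List ℤ} (n : ℕ) {T : List ℤ}
    (e : T = S ++ List.replicate n (-1)) (h : IsQDV (0 :: 1 :: 2 :: T))
    (hT : ∀ x ∈ T.head?, x ≤ 2) (hS : ∀ x ∈ S, -1 ≤ x ∧ x ≤ 2)
    (hp : S.Pairwise fun x y => y ≤ x + 2 ∧ x ≤ y + 3) :
    DyckClass.IsBalanced (dyckClass _ h) := by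
  have e2 : 0 :: (0 :: (0 :: T.map (· + -2)).map (· + 1)).map (· + 1) = 0 :: 1 :: 2 :: T := by
    simp [Function.comp_def, add_assoc]
  have hq : IsQDV (0 :: T.map (· + -2)) := by
    rw [isQDV_zero_cons]
    obtain ⟨-, h⟩ := h
    rw [List.isChain_cons, List.isChain_cons, List.isChain_cons] at h
    constructor
    · intro y hy
      simp only [List.head?_map, Option.mem_def, Option.map_eq_some_iff] at hy
      obtain ⟨z, hz, rfl⟩ := hy
      have := hT z hz
      omega
    · rw [List.isChain_map]
      exact h.2.2.2.imp fun a b h => by omega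
  refine ⟨T.map (· + -2), hq, ⟨?_, ?_, ?_⟩, ?_⟩
  · intro y hy
    simp only [List.head?_map, Option.mem_def, Option.map_eq_some_iff] at hy
    obtain ⟨z, hz, rfl⟩ := hy
    have := hT z hz
    omega
  · intro y hy
    rw [e] at hy
    simp only [List.mem_map, List.mem_append, List.mem_replicate] at hy
    obtain ⟨z, hz | hz, rfl⟩ := hy
    · have := hS z hz; omega
    · omega
  · rw [e, List.pairwise_map, List.pairwise_append]
    refine ⟨hp.imp fun h => by omega, List.pairwise_replicate.2 (Or.inr (by omega)), ?_⟩
    intro x hx y hy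
    obtain rfl := List.eq_of_mem_replicate hy
    have := hS x hx
    omega
  · rw [dyckClass_shift hq, dyckClass_shift hq.shift]
    simp only [e2]

theorem pairwise_of_mem_range {l : List ℤ} (h : ∀ x ∈ l, -1 ≤ x ∧ x ≤ 2)
    (h' : l.Pairwise fun x y => y ≤ x + 2 ∧ x ≤ y + 3) {y : ℤ} (hy : 0 ≤ y) (hy' : y ≤ 2) (n : ℕ) :
    (List.replicate n y ++ l).Pairwise fun x y => y ≤ x + 2 ∧ x ≤ y + 3 := by
  rw [List.pairwise_append]
  refine ⟨List.pairwise_replicate.2 (Or.inr (by omega)), h', ?_⟩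
  intro x hx z hz
  obtain rfl := List.eq_of_mem_replicate hx
  have := h z hz
  omega

/-- The minimal representative of d is the output word itself. Balance between a letter of A or B
and the final 1 forces that letter to be at least -1, which the auxiliary lemma requires. -/
theorem isBalanced_of_NU2 {c d : DyckClass} (h : NU2 c d) (hd : d.IsBalanced) :
    c.IsBalanced := by
  obtain ⟨T, hT, hb, e⟩ := hd
  cases h with
  | ruleA h hh A hA =>
    obtain ⟨m, rfl⟩ : ∃ m, h = m + 2 := ⟨h - 2, by omega⟩
    have eT : T = List.replicate (m + 1) 0 ++ 1 :: (A ++ List.replicate (m + 2) 1) :=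
      eq_of_isMinimal hb.isMinimal (by simp [IsMinimal, List.replicate_succ]) hT (hA.isQDV_out (h := m + 2)) e
    obtain ⟨-, -, hp⟩ := hb
    rw [eT, List.pairwise_append, List.pairwise_cons, List.pairwise_append] at hp
    obtain ⟨-, ⟨-, hp, -, hp'⟩, -⟩ := hp
    have hr : ∀ x ∈ A, -1 ≤ x ∧ x ≤ 2 := fun x hx => by
      have := hp' x hx 1 (by simp)
      have := hA.le_two x hx
      omega
    refine isBalanced_of_NU2_aux (S := List.replicate (m + 1) 2 ++ A) (m + 1)
      (T := List.replicate (m + 1) 2 ++ (A ++ List.replicate (m + 1) (-1))) (by simp) _ ?_ ?_ ?_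
    · simp [List.replicate_succ]
    · intro x hx
      rcases List.mem_append.1 hx with hx | hx
      · obtain rfl := List.eq_of_mem_replicate hx; omega
      · exact hr x hx
    · exact pairwise_of_mem_range hr hp (by norm_num) le_rfl _
  | ruleB k hk B hB =>
    obtain ⟨m, rfl⟩ : ∃ m, k = m + 1 := ⟨k - 1, by omega⟩
    have eT : T = List.replicate (m + 1) 0 ++ (B ++ 0 :: List.replicate (m + 1) 1) :=
      eq_of_isMinimal hb.isMinimal (by simp [IsMinimal, List.replicate_succ]) hT (hB.isQDV_out (k := m + 1)) e
    obtain ⟨-, -, hp⟩ := hb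
    rw [eT, List.pairwise_append, List.pairwise_append] at hp
    obtain ⟨-, ⟨hp, -, hp'⟩, -⟩ := hp
    have hr : ∀ x ∈ B, -1 ≤ x ∧ x ≤ 2 := fun x hx => by
      have := hp' x hx 1 (by simp)
      have := hB.le_two x hx
      omega
    refine isBalanced_of_NU2_aux (S := List.replicate m 2 ++ B) (m + 1)
      (T := List.replicate m 2 ++ (B ++ List.replicate (m + 1) (-1))) (by simp) _ ?_ ?_ ?_
    · intro x hx
      have hx := List.mem_of_mem_head? hx
      simp only [List.mem_append, List.mem_replicate] at hx
      rcases hx with hx | hx | hx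
      · omega
      · exact (hr x hx).2
      · omega
    · intro x hx
      rcases List.mem_append.1 hx with hx | hx
      · obtain rfl := List.eq_of_mem_replicate hx; omega
      · exact hr x hx
    · exact pairwise_of_mem_range hr hp (by norm_num) le_rfl _

theorem isBalanced_and_deficit_of_ND {c d : DyckClass} (h : ND c = some d) (hc : c.IsBalanced) :
    d.IsBalanced ∧ d.deficit = c.deficit := by
  rcases eq_or_NU2_of_ND h with ⟨h1, rfl⟩ | h1
  · obtain ⟨A, hA, hb, rfl⟩ := hc
    rcases List.eq_nil_or_concat' A with rfl | ⟨A, x, rfl⟩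
    · exact absurd h1 (not_inC1_of_nil hA)
    · have hx := (inC1_iff_of_isMinimal hb.isMinimal hA).1 h1
      obtain ⟨B, hB, e, hb'⟩ := hb.rotate hx hA
      rw [← e, ND_rotate]
      exact ⟨⟨_, _, hb', rfl⟩, (deficit_rotate B).symm⟩
  · exact ⟨isBalanced_of_NU2 h1 hc, deficit_of_NU2 h1⟩

theorem isBalanced_TI (mu : YoungDiagram) : (TI mu).IsBalanced := by
  refine ⟨wordB mu, isQDV_TI mu, ⟨?_, ?_, ?_⟩, rfl⟩
  · intro x hx
    unfold wordB at hx
    cases h : mu.rowLen 0 with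
    | zero => simp [h] at hx
    | succ n => simp [h, List.range_succ_eq_map] at hx; omega
  · intro x hx
    have := mem_wordB hx
    omega
  · apply List.pairwise_of_forall_mem_list
    intro x hx y hy
    have := mem_wordB hx
    have := mem_wordB hy
    omega

theorem TI2_properties (mu : YoungDiagram) :
    ((TI2 mu).IsBalanced ∧ (TI2 mu).deficit = (TI mu).deficit) ∧ ND (TI2 mu) = none :=
  iterateND_induction (P := fun c => c.IsBalanced ∧ c.deficit = (TI mu).deficit)
    (fun _ _ h hc => by
      obtain ⟨h1, h2⟩ := isBalanced_and_deficit_of_ND h hc.1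
      exact ⟨h1, h2.trans hc.2⟩) _ ⟨isBalanced_TI mu, rfl⟩

/-! ### Lower bounds for the deficit -/

/-- The indicator of `x = c`. -/
def ind (c x : ℤ) : ℤ := if x = c then 1 else 0

/-- Used to charge two units to each letter of a block, f collecting its pairs with a few fixed
letters. -/
theorem two_mul_length_le {f : ℤ → ℤ} {l : List ℤ} (h : ∀ x ∈ l, 2 ≤ f x) :
    2 * (l.length : ℤ) ≤ (l.map f).sum := by
  induction l with
  | nil => simp
  | cons x l ih =>
    have := ih fun y hy => h y (by simp [hy])
    have := h x (by simp)
    simp only [List.length_cons, List.map_cons, List.sum_cons]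
    push_cast
    omega

theorem sum_map_sub_int (f g : ℤ → ℤ) (l : List ℤ) :
    (l.map fun x => f x - g x).sum = (l.map f).sum - (l.map g).sum := by
  induction l with
  | nil => rfl
  | cons x l ih => simp only [List.map_cons, List.sum_cons, ih]; ring

/-- Splitting a word at the last occurrence of a letter. -/
theorem exists_last_occurrence {a : ℤ} {l : List ℤ} (h : a ∈ l) :
    ∃ P S, l = P ++ a :: S ∧ a ∉ S := by
  obtain ⟨s, t, e, hs⟩ := List.eq_append_cons_of_mem (List.mem_reverse.2 h)
  refine ⟨t.reverse, s.reverse, ?_, by simpa using hs⟩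
  rw [← List.reverse_reverse l, e]
  simp

/-- After the last occurrence of its minimal letter `a`, a quasi-Dyck word that ends with a
larger letter continues with `a + 1`. -/
theorem exists_last_occurrence_succ {a : ℤ} {l : List ℤ} (h : a ∈ l) (hmin : ∀ x ∈ l, a ≤ x)
    (hc : l.IsChain fun a b => b ≤ a + 1) (hlast : ∀ x ∈ l.getLast?, a < x) :
    ∃ P S, l = P ++ a :: (a + 1) :: S ∧ ∀ x ∈ S, a < x := by
  obtain ⟨P, S, rfl, hS⟩ := exists_last_occurrence h
  have hS' : ∀ x ∈ S, a < x := fun x hx => by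
    have := hmin x (by simp [hx])
    rcases eq_or_ne x a with rfl | hne
    · exact absurd hx hS
    · omega
  cases S with
  | nil => have := hlast a (by simp); omega
  | cons b S =>
    have hb := hS' b (by simp)
    rw [List.isChain_append, List.isChain_cons] at hc
    have := hc.2.1.1 b (by simp)
    obtain rfl : b = a + 1 := by omega
    exact ⟨P, S, rfl, fun x hx => hS' x (by simp [hx])⟩

/-- Write A = P 0 1 Q around the last 0. A letter of Q earns two units from this 0 and 1 and the
`ind 1` term. A letter of P earns two from the first letter of P, the 0, the 1 and one letter q of
Q, provided that q exists and that the first letter of P and q are not both 1. The excluded shapes P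
0 1 and 1 ⋯ 1 1 will be seen to lie in C_2. -/
theorem badPairs_bound_of_nonneg {A : List ℤ} (hr : ∀ x ∈ A, 0 ≤ x ∧ x ≤ 2)
    (hhead : ∀ x ∈ A.head?, x ≤ 1) (hc : A.IsChain fun a b => b ≤ a + 1)
    (hlast : ∀ x ∈ A.getLast?, 0 < x) :
    (∀ x ∈ A, 1 ≤ x) ∨ (∃ P, A = P ++ [0, 1]) ∨ (∃ P, A = 1 :: (P ++ [1, 1]) ∧
      ∀ x ∈ P.getLast?, 0 ≤ x) ∨
      2 * (A.length : ℤ) - 3 ≤ badPairs A + (A.map (ind 1)).sum := by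
  by_cases h0 : (0 : ℤ) ∈ A
  swap
  · left
    intro x hx
    have := hr x hx
    rcases eq_or_ne x 0 with rfl | hne
    · exact absurd hx h0
    · omega
  right
  obtain ⟨P, Q, rfl, hQ⟩ := exists_last_occurrence_succ h0 (fun x hx => (hr x hx).1) hc hlast
  rw [zero_add] at *
  have hQ' : ∀ x ∈ Q, x = 1 ∨ x = 2 := fun x hx => by
    have := hQ x hx
    have := hr x (by simp [hx])
    omega
  have bQ : 2 * (Q.length : ℤ) ≤ (Q.map fun x => nd 0 x + nd 1 x + ind 1 x).sum :=
    two_mul_length_le fun x hx => by rcases hQ' x hx with rfl | rfl <;> decide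
  have bQ0 := badPairs_nonneg Q
  simp only [List.sum_map_add] at bQ
  cases P with
  | nil =>
    right; right
    simp only [List.nil_append, badPairs, List.map_cons, List.sum_cons, List.length_cons]
    have : nd 0 1 = 1 := rfl
    have : ind 1 1 = 1 := rfl
    have : ind 1 0 = 0 := rfl
    push_cast
    omega
  | cons y P =>
    have hy := hhead y (by simp)
    have hy0 := (hr y (by simp)).1
    have hP : ∀ x ∈ P, x = 0 ∨ x = 1 ∨ x = 2 := fun x hx => by
      have := hr x (by simp [hx])
      omega
    have key : ∀ q ∈ Q, (∀ x ∈ P, 2 ≤ nd y x + nd x 0 + nd x 1 + nd x q + ind 1 x) →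
        3 ≤ nd y 0 + nd y 1 + nd y q + 1 + ind 1 y →
        2 * (((y :: P) ++ 0 :: 1 :: Q).length : ℤ) - 3 ≤
        badPairs ((y :: P) ++ 0 :: 1 :: Q) + (((y :: P) ++ 0 :: 1 :: Q).map (ind 1)).sum := by
      intro q hq h1 h2
      have b1 := two_mul_length_le h1
      have b2 := sum_nd_le_cross (v := P) hq
      have b3 := badPairs_nonneg P
      have b4 : nd y q ≤ (Q.map (nd y)).sum :=
        List.single_le_sum (fun x hx => by
          obtain ⟨z, -, rfl⟩ := List.mem_map.1 hx
          exact nd_nonneg _ _) _ (List.mem_map_of_mem hq)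
      simp only [List.sum_map_add] at b1
      simp only [badPairs, badPairs_append, cross_cons_right, List.cons_append, List.map_cons,
        List.sum_cons, List.map_append, List.sum_append, List.length_cons, List.length_append]
      have : nd 0 1 = 1 := rfl
      have : ind 1 1 = 1 := rfl
      have : ind 1 0 = 0 := rfl
      push_cast
      omega
    cases Q with
    | nil => exact Or.inl ⟨y :: P, rfl⟩
    | cons q Q =>
      right
      obtain rfl | rfl : y = 0 ∨ y = 1 := by omega
      · right
        apply key q (by simp)
        · intro x hx
          rcases hP x hx with rfl | rfl | rfl <;> rcases hQ' q (by simp) with rfl | rfl <;> decide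
        · rcases hQ' q (by simp) with rfl | rfl <;> decide
      -- With first letter 1, a letter 1 of P earns its second unit only from q = 2. Without a 2, Q
      -- consists of ones and A ends in 11.
      · by_cases h2 : (2 : ℤ) ∈ q :: Q
        · right
          apply key 2 h2
          · intro x hx
            rcases hP x hx with rfl | rfl | rfl <;> decide
          · decide
        · left
          have e : q :: Q = List.replicate (Q.length + 1) 1 := by
            rw [List.eq_replicate_iff]
            refine ⟨rfl, fun x hx => ?_⟩
            rcases hQ' x hx with rfl | rfl
            · rfl
            · exact absurd hx h2
          refine ⟨P ++ 0 :: List.replicate Q.length 1, ?_, ?_⟩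
          · have e' : ∀ n, (1 : ℤ) :: List.replicate (n + 1) 1 = List.replicate n 1 ++ [1, 1] := by
              intro n
              rw [← List.replicate_succ, List.replicate_succ', List.replicate_succ']
              simp
            rw [e, e']
            simp
          · intro x hx
            have := List.mem_of_mem_getLast? hx
            simp only [List.mem_append, List.mem_cons, List.mem_replicate] at this
            rcases this with h | h | h
            · have := hP x h; omega
            · omega
            · omega

/-- Write A = P (-1) Q 0 1 R, taking the last -1 and the last 0. The letters -1, 0, 1 form three bad
pairs, which is 2 · 3 - 3. Every other letter earns two units net of the `ind 2` term, from these
three letters, the first letter of its own block and, when P starts with 0, a letter of R. If then R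
is empty, A has the excluded shape. -/
theorem badPairs_bound_of_neg_one_mem {A : List ℤ} (hr : ∀ x ∈ A, -1 ≤ x ∧ x ≤ 2)
    (hhead : ∀ x ∈ A.head?, x ≤ 0) (hc : A.IsChain fun a b => b ≤ a + 1)
    (hlast : ∀ x ∈ A.getLast?, 0 < x) (hmem : -1 ∈ A) :
    (∃ B, A = 0 :: (B ++ [0, 1])) ∨
      2 * (A.length : ℤ) - 3 ≤ badPairs A - (A.map (ind 2)).sum := by
  obtain ⟨P, S, rfl, hS⟩ := exists_last_occurrence_succ hmem (fun x hx => (hr x hx).1) hc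
    (fun x hx => by have := hlast x hx; omega)
  rw [show (-1 : ℤ) + 1 = 0 by rfl] at *
  have hc' : (0 :: S).IsChain fun a b : ℤ => b ≤ a + 1 := by
    rw [List.isChain_append, List.isChain_cons] at hc
    exact hc.2.1.2
  obtain ⟨Q, R, e, hR⟩ := exists_last_occurrence_succ (a := 0) (l := 0 :: S) (by simp)
    (fun x hx => by
      rcases List.mem_cons.1 hx with hx | hx
      · omega
      · have := hS x hx; omega) hc'
    (fun x hx => hlast x (by
      rw [List.getLast?_append, List.getLast?_cons_cons, hx]; rfl))
  rw [zero_add] at e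
  have hQ0 : ∀ x ∈ Q, x = 0 ∨ x = 1 ∨ x = 2 := fun x hx => by
    have h1 : x ∈ 0 :: S := by rw [e]; simp [hx]
    rcases List.mem_cons.1 h1 with h1 | h1
    · exact Or.inl h1
    · have := hS x h1
      have := hr x (by simp [h1])
      omega
  have hR0 : ∀ x ∈ R, x = 1 ∨ x = 2 := fun x hx => by
    have h1 : x ∈ 0 :: S := by rw [e]; simp [hx]
    have := hR x hx
    have := hr x (by simp only [List.mem_append, List.mem_cons] at h1 ⊢; tauto)
    omega
  have bR : 2 * (R.length : ℤ) ≤ (R.map fun x => nd (-1) x + nd 0 x + nd 1 x - ind 2 x).sum :=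
    two_mul_length_le fun x hx => by rcases hR0 x hx with rfl | rfl <;> decide
  -- A nonempty Q starts with the 0 that follows the last -1; its other letters also use their pair
  -- with this 0.
  have bQ : 2 * (Q.length : ℤ) ≤ badPairs Q + (Q.map (nd (-1))).sum + (Q.map (nd · 0)).sum +
      (Q.map (nd · 1)).sum - (Q.map (ind 2)).sum := by
    cases Q with
    | nil => simp [badPairs]
    | cons q Q =>
      obtain rfl : q = 0 := by simp at e; exact e.1.symm
      have b1 : 2 * (Q.length : ℤ) ≤
          (Q.map fun x => nd (-1) x + nd x 0 + nd x 1 + nd 0 x - ind 2 x).sum :=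
        two_mul_length_le fun x hx => by
          rcases hQ0 x (by simp [hx]) with rfl | rfl | rfl <;> decide
      have b2 := badPairs_nonneg Q
      simp only [sum_map_sub_int, List.sum_map_add] at b1
      simp only [badPairs, List.map_cons, List.sum_cons, List.length_cons]
      have : nd (-1) 0 = 1 := rfl
      have : nd 0 1 = 1 := rfl
      have : nd 0 0 = 0 := rfl
      have : ind 2 0 = 0 := rfl
      push_cast
      omega
  -- Only the letters of P remain to be accounted for.
  have fin : 2 * (P.length : ℤ) ≤ badPairs P + (P.map (nd · (-1))).sum + (P.map (nd · 0)).sum +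
      (P.map (nd · 1)).sum + cross P R - (P.map (ind 2)).sum →
      2 * ((P ++ -1 :: 0 :: S).length : ℤ) - 3 ≤
        badPairs (P ++ -1 :: 0 :: S) - ((P ++ -1 :: 0 :: S).map (ind 2)).sum := by
    intro bP
    rw [e]
    simp only [sum_map_sub_int, List.sum_map_add] at bR
    have b1 := badPairs_nonneg R
    have b2 := cross_nonneg Q R
    have b3 := cross_nonneg P Q
    simp only [badPairs, badPairs_append, cross_cons_right, cross_append_right, List.map_cons,
      List.sum_cons, List.map_append, List.sum_append, List.length_cons, List.length_append]
    have : nd (-1) 0 = 1 := rfl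
    have : nd (-1) 1 = 1 := rfl
    have : nd 0 1 = 1 := rfl
    have : ind 2 (-1) = 0 := rfl
    have : ind 2 0 = 0 := rfl
    have : ind 2 1 = 0 := rfl
    push_cast
    omega
  cases P with
  | nil => exact Or.inr (fin (by simp [badPairs, cross_nil_left]))
  | cons y P =>
    have hP : ∀ x ∈ P, x = -1 ∨ x = 0 ∨ x = 1 ∨ x = 2 := fun x hx => by
      have := hr x (by simp [hx])
      omega
    have hy := hhead y (by simp)
    have hy0 := (hr y (by simp)).1
    have b2 := badPairs_nonneg P
    obtain rfl | rfl : y = -1 ∨ y = 0 := by omega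
    · right
      apply fin
      have b1 : 2 * (P.length : ℤ) ≤
          (P.map fun x => nd (-1) x + nd x (-1) + nd x 0 + nd x 1 - ind 2 x).sum :=
        two_mul_length_le fun x hx => by rcases hP x hx with rfl | rfl | rfl | rfl <;> decide
      have b3 := cross_nonneg (-1 :: P) R
      simp only [sum_map_sub_int, List.sum_map_add] at b1
      simp only [badPairs, List.map_cons, List.sum_cons, List.length_cons]
      have : nd (-1) (-1) = 0 := rfl
      have : nd (-1) 0 = 1 := rfl
      have : nd (-1) 1 = 1 := rfl
      have : ind 2 (-1) = 0 := rfl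
      push_cast
      omega
    · cases R with
      | nil =>
        left
        refine ⟨P ++ -1 :: Q, ?_⟩
        rw [e]
        simp
      | cons r R =>
        right
        apply fin
        have hr' := hR0 r (by simp)
        have b1 : 2 * (P.length : ℤ) ≤
            (P.map fun x => nd 0 x + nd x (-1) + nd x 0 + nd x 1 + nd x r - ind 2 x).sum :=
          two_mul_length_le fun x hx => by
            rcases hr' with rfl | rfl <;> rcases hP x hx with rfl | rfl | rfl | rfl <;> decide
        have b3 := cross_nonneg (0 :: P) R
        simp only [sum_map_sub_int, List.sum_map_add] at b1
        simp only [badPairs, List.map_cons, List.sum_cons, List.length_cons, cross_cons_right]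
        have : nd 0 (-1) = 0 := rfl
        have : nd 0 0 = 0 := rfl
        have : nd 0 1 = 1 := rfl
        have : nd 0 r = 1 := by rcases hr' with rfl | rfl <;> rfl
        have : ind 2 0 = 0 := rfl
        push_cast
        omega

/-! ### The minimum triangle height -/

theorem rowLen_staircase (n i : ℕ) : (staircase n).rowLen i = n - 1 - i := by
  rw [staircase, rowLen_ofRowLens_eq_getD]
  rcases Nat.lt_or_ge i n with h | h
  · rw [List.getD_eq_getElem _ _ (by simpa using h)]
    simp
  · rw [List.getD_eq_default _ _ (by simpa using h)]
    omega

theorem le_of_rowLen_le {γ δ : YoungDiagram} (h : ∀ i, γ.rowLen i ≤ δ.rowLen i) : γ ≤ δ := by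
  rintro ⟨i, j⟩ hx
  exact YoungDiagram.mem_iff_lt_rowLen.2 ((YoungDiagram.mem_iff_lt_rowLen.1 hx).trans_le (h i))

/-- A letter v_j ≥ 0 gives the part j - v_j ≤ j, and j is the corresponding part of the staircase.
-/
theorem mind_mem_of_nonneg {v : List ℤ} (hv : IsQDV v) (h : ∀ x ∈ v, 0 ≤ x) :
    v.length ∈ {n | (partitionOfQDV ⟨v, hv⟩).colLen 0 < n ∧
      partitionOfQDV ⟨v, hv⟩ ≤ staircase n} := by
  refine ⟨colLen_partitionOfQDV_lt ⟨v, hv⟩, le_of_rowLen_le fun i => ?_⟩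
  rw [rowLen_staircase]
  rcases Nat.lt_or_ge i v.length with hi | hi
  · have h1 := rowLen_partitionOfQDV ⟨v, hv⟩ (j := v.length - 1 - i) (by simp; omega)
    have h2 := h v[v.length - 1 - i] (List.getElem_mem _)
    simp only [show v.length - 1 - (v.length - 1 - i) = i by omega] at h1
    omega
  · rw [rowLen_partitionOfQDV_of_ge _ hi]
    omega

theorem mind_le_of_nonneg {v : List ℤ} (hv : IsQDV v) (h : ∀ x ∈ v, 0 ≤ x) :
    (dyckClass v hv).mind ≤ v.length :=
  Nat.sInf_le (mind_mem_of_nonneg hv h)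

/-- The lower bound is the condition n > ℓ in the definition of mind. -/
theorem mind_eq_of_isMinimal {A : List ℤ} (hA : IsMinimal A) (hv : IsQDV (0 :: A))
    (h : ∀ x ∈ A, 0 ≤ x) : (dyckClass _ hv).mind = A.length + 1 := by
  have h' : ∀ x ∈ 0 :: A, 0 ≤ x := by simpa using h
  apply le_antisymm (mind_le_of_nonneg hv h')
  refine le_csInf ⟨_, mind_mem_of_nonneg hv h'⟩ ?_
  rintro n ⟨hn, -⟩
  rw [symm_dyckClass, ← length_eq_of_isMinimal hA hv] at hn
  exact hn

/-! ### The binary words `B_lam` -/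

/-- The word `0 1^{f 0} 0 1^{f 1} ⋯ 0 1^{f (r-1)}`. -/
def blockWord (r : ℕ) (f : ℕ → ℕ) : List ℤ :=
  (List.range r).flatMap fun i => 0 :: List.replicate (f i) 1

theorem blockWord_succ (r : ℕ) (f : ℕ → ℕ) :
    blockWord (r + 1) f = blockWord r f ++ 0 :: List.replicate (f r) 1 := by
  simp [blockWord, List.range_succ]

theorem blockWord_congr {r : ℕ} {f g : ℕ → ℕ} (h : ∀ i < r, f i = g i) :
    blockWord r f = blockWord r g := by
  unfold blockWord
  rw [List.flatMap_def, List.flatMap_def, List.map_congr_left]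
  intro i hi
  rw [h i (List.mem_range.1 hi)]

theorem length_blockWord (r : ℕ) (f : ℕ → ℕ) :
    (blockWord r f).length = r + ∑ i ∈ Finset.range r, f i := by
  induction r with
  | zero => rfl
  | succ r ih =>
    rw [blockWord_succ, List.length_append, ih, Finset.sum_range_succ]
    simp
    omega

theorem sum_map_blockWord (g : ℤ → ℤ) (r : ℕ) (f : ℕ → ℕ) :
    ((blockWord r f).map g).sum = r * g 0 + (∑ i ∈ Finset.range r, f i : ℕ) * g 1 := by
  induction r with
  | zero => simp [blockWord]
  | succ r ih =>
    rw [blockWord_succ, List.map_append, List.sum_append, ih, Finset.sum_range_succ]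
    simp
    ring

/-- In a binary word the bad pairs are those with 0 before 1, and a 1 of block i (counted from 0) is
preceded by i + 1 zeros. -/
theorem badPairs_blockWord (r : ℕ) (f : ℕ → ℕ) :
    badPairs (blockWord r f) = (∑ i ∈ Finset.range r, (i + 1) * f i : ℕ) := by
  induction r with
  | zero => rfl
  | succ r ih =>
    rw [blockWord_succ, badPairs_append, ih, Finset.sum_range_succ, cross_cons_right,
      cross_replicate_right, sum_map_blockWord, sum_map_blockWord, badPairs, badPairs_replicate,
      List.map_replicate, List.sum_replicate]
    rw [show nd 0 0 = 0 by rfl, show nd 0 1 = 1 by rfl, show nd 1 0 = 0 by rfl,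
      show nd 1 1 = 0 by rfl, nsmul_eq_mul]
    push_cast
    ring

theorem sum_count_eq_length {r : ℕ} {l : List ℕ} (h : ∀ x ∈ l, 1 ≤ x ∧ x ≤ r) :
    ∑ i ∈ Finset.range r, l.count (i + 1) = l.length := by
  induction l with
  | nil => simp
  | cons a l ih =>
    obtain ⟨h1, h2⟩ := h a (by simp)
    obtain ⟨b, rfl⟩ : ∃ b, a = b + 1 := ⟨a - 1, by omega⟩
    simp only [List.count_cons, Finset.sum_add_distrib, ih fun x hx => h x (by simp [hx]),
      List.length_cons, beq_iff_eq, Nat.add_right_cancel_iff]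
    rw [Finset.sum_ite_eq, if_pos (Finset.mem_range.2 (by omega))]

theorem sum_mul_count_eq_sum {r : ℕ} {l : List ℕ} (h : ∀ x ∈ l, 1 ≤ x ∧ x ≤ r) :
    ∑ i ∈ Finset.range r, (i + 1) * l.count (i + 1) = l.sum := by
  induction l with
  | nil => simp
  | cons a l ih =>
    obtain ⟨h1, h2⟩ := h a (by simp)
    obtain ⟨b, rfl⟩ : ∃ b, a = b + 1 := ⟨a - 1, by omega⟩
    simp only [List.count_cons, mul_add, Finset.sum_add_distrib,
      ih fun x hx => h x (by simp [hx]), List.sum_cons, beq_iff_eq, Nat.add_right_cancel_iff,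
      mul_ite, mul_one, mul_zero]
    rw [Finset.sum_ite_eq, if_pos (Finset.mem_range.2 (by omega))]
    omega

theorem mem_rowLens_range {lam : YoungDiagram} {x : ℕ} (hx : x ∈ lam.rowLens) :
    1 ≤ x ∧ x ≤ lam.rowLen 0 := by
  refine ⟨lam.pos_of_mem_rowLens x hx, ?_⟩
  obtain ⟨i, -, rfl⟩ := List.mem_map.1 (show x ∈ (List.range (lam.colLen 0)).map lam.rowLen from hx)
  exact lam.rowLen_anti 0 i (Nat.zero_le i)

theorem wordB_eq (lam : YoungDiagram) :
    wordB lam = blockWord (lam.rowLen 0) fun i => lam.rowLens.count (i + 1) := rfl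

theorem sum_count_rowLens (lam : YoungDiagram) :
    ∑ i ∈ Finset.range (lam.rowLen 0), lam.rowLens.count (i + 1) = lam.colLen 0 := by
  rw [sum_count_eq_length fun x hx => mem_rowLens_range hx, lam.length_rowLens]

theorem length_wordB (lam : YoungDiagram) :
    (wordB lam).length = lam.rowLen 0 + lam.colLen 0 := by
  rw [wordB_eq, length_blockWord, sum_count_rowLens]

theorem sum_map_wordB (g : ℤ → ℤ) (lam : YoungDiagram) :
    ((wordB lam).map g).sum = lam.rowLen 0 * g 0 + lam.colLen 0 * g 1 := by
  rw [wordB_eq, sum_map_blockWord, sum_count_rowLens]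

theorem badPairs_wordB (lam : YoungDiagram) : badPairs (wordB lam) = lam.card := by
  rw [wordB_eq, badPairs_blockWord, sum_mul_count_eq_sum fun x hx => mem_rowLens_range hx,
    card_eq_sum_rowLens]

/-! ### Deficit and triangle height of tail initiators and flag words -/

/-- The bad pairs of the leading 0 with the ones cancel the weights of the ones. -/
theorem deficit_TI (mu : YoungDiagram) : (TI mu).deficit = mu.card := by
  rw [TI, deficit_dyckClass, deficit, badPairs, badPairs_wordB, List.map_cons, List.sum_cons,
    sum_map_wordB, sum_map_wordB]
  rw [show nd 0 0 = 0 by rfl, show nd 0 1 = 1 by rfl, show wt 0 = 0 by rfl, show wt 1 = 1 by rfl]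
  ring

theorem deficit_flagWord0 (lam : YoungDiagram) (a : ℕ) :
    deficit (flagWord0 lam a) = a + 1 + lam.rowLen 0 + lam.colLen 0 + lam.card := by
  simp only [flagWord0, deficit, badPairs, badPairs_append, badPairs_map_add, badPairs_replicate,
    badPairs_wordB, cross_replicate_left, List.map_cons, List.map_append, List.map_replicate,
    List.map_map, Function.comp_def, List.sum_cons, List.sum_append, List.sum_replicate,
    sum_map_wordB]
  simp only [nd, wt]
  norm_num
  ring

/-- The value is that of `flagWord0`: a letter 2 has been rotated to the end as a 1. For a = 0 the
exponent a - 1 would be truncated. -/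
theorem deficit_flagWord1 (lam : YoungDiagram) {a : ℕ} (ha : 1 ≤ a) :
    deficit (flagWord1 lam a) = a + 1 + lam.rowLen 0 + lam.colLen 0 + lam.card := by
  obtain ⟨a, rfl⟩ : ∃ b, a = b + 1 := ⟨a - 1, by omega⟩
  simp only [flagWord1, deficit, badPairs, badPairs_append, badPairs_map_add, badPairs_replicate,
    badPairs_wordB, cross_replicate_left, List.map_cons, List.map_append, List.map_replicate,
    List.map_map, Function.comp_def, List.sum_cons, List.sum_append, List.sum_replicate,
    sum_map_wordB, cross_cons_right, cross_nil_right, List.map_nil,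
    List.sum_nil, Nat.add_sub_cancel]
  simp only [nd, wt]
  norm_num
  ring

theorem mind_flagWord0 (lam : YoungDiagram) (a : ℕ) :
    (dyckClass _ (isQDV_flagWord0 lam a)).mind = a + 3 + lam.rowLen 0 + lam.colLen 0 := by
  refine (mind_eq_of_isMinimal ?_ (isQDV_flagWord0 lam a) ?_).trans ?_
  · simp [IsMinimal]
  · intro x hx
    simp only [List.mem_cons, List.mem_append, List.mem_map, List.mem_replicate] at hx
    rcases hx with hx | hx | hx | ⟨y, hy, rfl⟩
    iterate 3 omega
    have := mem_wordB hy
    omega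
  · simp [length_wordB]; omega

theorem mind_flagWord1 (lam : YoungDiagram) {a : ℕ} (ha : 1 ≤ a) :
    (dyckClass _ (isQDV_flagWord1 lam a)).mind = a + 3 + lam.rowLen 0 + lam.colLen 0 := by
  refine (mind_eq_of_isMinimal ?_ (isQDV_flagWord1 lam a) ?_).trans ?_
  · simp [IsMinimal]
  · intro x hx
    simp only [List.mem_cons, List.mem_append, List.mem_map, List.mem_replicate,
      List.not_mem_nil, or_false] at hx
    rcases hx with hx | hx | (hx | ⟨y, hy, rfl⟩) | hx
    iterate 3 omega
    · have := mem_wordB hy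
      omega
    · omega
  · simp [length_wordB]; omega

/-! ### Partitions from binary words -/

/-- The parts, in decreasing order, of the partition with `f i` parts equal to `i + 1` for
`i < r`. -/
def blockParts : ℕ → (ℕ → ℕ) → List ℕ
  | 0, _ => []
  | r + 1, f => List.replicate (f r) (r + 1) ++ blockParts r f

theorem mem_blockParts {r : ℕ} {f : ℕ → ℕ} {x : ℕ} (h : x ∈ blockParts r f) : 1 ≤ x ∧ x ≤ r := by
  induction r with
  | zero => simp [blockParts] at h
  | succ r ih =>
    rcases List.mem_append.1 h with h | h
    · have := List.eq_of_mem_replicate h; omega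
    · have := ih h; omega

theorem sortedGE_blockParts (r : ℕ) (f : ℕ → ℕ) : (blockParts r f).SortedGE := by
  rw [List.sortedGE_iff_pairwise]
  induction r with
  | zero => exact List.Pairwise.nil
  | succ r ih =>
    rw [blockParts, List.pairwise_append]
    refine ⟨List.pairwise_replicate.2 (Or.inr le_rfl), ih, ?_⟩
    intro x hx y hy
    have := List.eq_of_mem_replicate hx
    have := mem_blockParts hy
    omega

theorem count_blockParts {r : ℕ} (f : ℕ → ℕ) {i : ℕ} (hi : i < r) :
    (blockParts r f).count (i + 1) = f i := by
  induction r with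
  | zero => omega
  | succ r ih =>
    rw [blockParts, List.count_append, List.count_replicate]
    rcases Nat.lt_or_ge i r with h | h
    · rw [ih h, if_neg (by simp; omega), zero_add]
    · obtain rfl : i = r := by omega
      have : (blockParts i f).count (i + 1) = 0 := by
        rw [List.count_eq_zero]
        intro h
        have := mem_blockParts h
        omega
      simp [this]

theorem exists_blockWord {W : List ℤ} (hW : ∀ x ∈ W, x = 0 ∨ x = 1) (hhead : ∀ x ∈ W.head?, x = 0) :
    ∃ r f, W = blockWord r f := by
  induction W using List.reverseRecOn with
  | nil => exact ⟨0, fun _ => 0, rfl⟩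
  | append_singleton W x ih =>
    have h1 : ∀ y ∈ W.head?, y = 0 := by
      intro y hy
      apply hhead
      rw [List.head?_append, hy]
      rfl
    obtain ⟨r, f, rfl⟩ := ih (fun y hy => hW y (by simp [hy])) h1
    -- A new 0 opens an empty block; a new 1 lengthens the last block, which exists because the word
    -- starts with 0.
    rcases hW x (by simp) with rfl | rfl
    · refine ⟨r + 1, Function.update f r 0, ?_⟩
      rw [blockWord_succ, Function.update_self]
      congr 1
      exact blockWord_congr fun i hi => (Function.update_of_ne (by omega) _ _).symm
    · cases r with
      | zero => simp [blockWord] at hhead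
      | succ r =>
        refine ⟨r + 1, Function.update f r (f r + 1), ?_⟩
        rw [blockWord_succ, blockWord_succ, Function.update_self, List.replicate_succ',
          List.append_assoc, List.cons_append]
        congr 1
        exact blockWord_congr fun i hi => (Function.update_of_ne (by omega) _ _).symm

/-- Every binary word that is empty or starts with `0` and ends with `1` is a word `B_lam`. -/
theorem exists_wordB {W : List ℤ} (hW : ∀ x ∈ W, x = 0 ∨ x = 1) (hhead : ∀ x ∈ W.head?, x = 0)
    (hlast : ∀ x ∈ W.getLast?, x = 1) : ∃ lam, wordB lam = W := by
  obtain ⟨r, f, rfl⟩ := exists_blockWord hW hhead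
  refine ⟨YoungDiagram.ofRowLens (blockParts r f) (sortedGE_blockParts r f), ?_⟩
  have h0 : (YoungDiagram.ofRowLens (blockParts r f) (sortedGE_blockParts r f)).rowLen 0 = r := by
    rw [rowLen_ofRowLens_eq_getD]
    cases r with
    | zero => rfl
    | succ r =>
      -- The final letter 1 makes the last block nonempty, so the largest part is the number of
      -- blocks.
      have hf : f r ≠ 0 := by
        intro hf
        have := hlast 0 (by rw [blockWord_succ, hf]; simp)
        omega
      obtain ⟨m, hm⟩ := Nat.exists_eq_succ_of_ne_zero hf
      rw [blockParts, hm, List.replicate_succ]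
      rfl
  rw [wordB_eq, h0, YoungDiagram.rowLens_ofRowLens_eq_self fun x hx => (mem_blockParts hx).1]
  exact blockWord_congr fun i hi => count_blockParts f hi

/-! ### Classes that `ND` does not move -/

theorem not_inC1_of_ND_eq_none {c : DyckClass} (h : ND c = none) : ¬ InC1 (dyckEquiv.symm c) := by
  intro h1
  rw [ND, if_pos h1] at h
  exact Option.some_ne_none _ h

theorem not_NU2_of_ND_eq_none {c : DyckClass} (h : ND c = none) (d : DyckClass) : ¬ NU2 d c := by
  intro h1
  rw [ND_eq_some_of_NU2 h1] at h
  exact Option.some_ne_none _ h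

/-- Peel off the initial twos; the rest, lowered by 1, is empty or starts with 0 and ends with 1. -/
theorem exists_eq_replicate_append_wordB {w : List ℤ} (hw : ∀ x ∈ w, x = 1 ∨ x = 2)
    (hlast : ∀ x ∈ w.getLast?, x = 2) :
    ∃ (b : ℕ) (lam : YoungDiagram), w = List.replicate b 2 ++ (wordB lam).map (· + 1) := by
  induction w with
  | nil =>
    obtain ⟨lam, hl⟩ := exists_wordB (W := []) (by simp) (by simp) (by simp)
    exact ⟨0, lam, by simp [hl]⟩
  | cons y w ih =>
    rcases hw y (by simp) with rfl | rfl
    · obtain ⟨lam, hl⟩ := exists_wordB (W := (1 :: w).map (· + -1)) (by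
          intro x hx
          obtain ⟨z, hz, rfl⟩ := List.mem_map.1 hx
          have := hw z hz
          omega) (by simp) (by
          intro x hx
          rw [List.getLast?_map, Option.mem_def, Option.map_eq_some_iff] at hx
          obtain ⟨z, hz, rfl⟩ := hx
          rw [hlast z hz]
          rfl)
      refine ⟨0, lam, ?_⟩
      rw [hl]
      simp [Function.comp_def]
    · obtain ⟨b, lam, h⟩ := ih (fun x hx => hw x (by simp [hx])) (fun x hx => by
        apply hlast
        rw [List.getLast?_cons, hx]
        rfl)
      exact ⟨b + 1, lam, by rw [List.replicate_succ, List.cons_append, ← h]⟩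

/-- The two kinds of flag word correspond to w ending in no 1 or in exactly one; if w ends in 11,
rule A with h = 2 produces the word. -/
theorem exists_flagWord {w : List ℤ} (hw : ∀ x ∈ w, x = 1 ∨ x = 2)
    (hv : IsQDV (0 :: 0 :: 1 :: w)) (hN : ∀ d, ¬ NU2 d (dyckClass _ hv)) :
    ∃ (lam : YoungDiagram) (a : ℕ), 0 :: 0 :: 1 :: w = flagWord0 lam a ∨
      (1 ≤ a ∧ 0 :: 0 :: 1 :: w = flagWord1 lam a) := by
  by_cases h2 : ∀ x ∈ w.getLast?, x = 2
  · obtain ⟨b, lam, h⟩ := exists_eq_replicate_append_wordB hw h2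
    exact ⟨lam, b, Or.inl (by rw [h, flagWord0])⟩
  rcases List.eq_nil_or_concat' w with rfl | ⟨w, x, rfl⟩
  · simp at h2
  obtain rfl : x = 1 := by
    simp at h2
    have := hw x (by simp)
    omega
  by_cases h3 : ∀ x ∈ w.getLast?, x = 2
  · obtain ⟨b, lam, h⟩ := exists_eq_replicate_append_wordB (fun x hx => hw x (by simp [hx])) h3
    exact ⟨lam, b + 1, Or.inr ⟨by omega, by rw [h, flagWord1, Nat.add_sub_cancel]⟩⟩
  rcases List.eq_nil_or_concat' w with rfl | ⟨w, x, rfl⟩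
  · simp at h3
  obtain rfl : x = 1 := by
    simp at h3
    have := hw x (by simp)
    omega
  exfalso
  have hA : AdmissibleA w := by
    refine ⟨fun x hx => ?_, fun x hx => ?_, isChain_of_two 1 fun x hx => hw x (by simp [hx])⟩
    · have := hw x (by simp [hx]); omega
    · have := hw x (by simp [List.mem_of_mem_getLast? hx]); omega
  have e : wordAOut 2 w = 0 :: 0 :: 1 :: (w ++ [1] ++ [1]) := by simp [wordAOut]
  have := NU2.ruleA 2 le_rfl w hA
  simp only [e] at this
  exact hN _ this

/-- The word is an output of rule B with k = 1. -/
theorem not_ND_eq_none_of_ruleB {B : List ℤ} (hr : ∀ x ∈ B, -1 ≤ x ∧ x ≤ 2)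
    (hv : IsQDV (0 :: 0 :: (B ++ [0, 1]))) : ND (dyckClass _ hv) ≠ none := by
  intro h
  have hc := hv.2
  rw [List.isChain_cons, List.isChain_cons, List.isChain_append] at hc
  have hB : AdmissibleB B := by
    refine ⟨fun x hx => (hr x hx).2, fun x hx => ?_,
      fun x hx => (hr x (List.mem_of_mem_getLast? hx)).1, hc.2.2.1⟩
    have := hc.2.1 x (by rw [List.head?_append, hx]; rfl)
    omega
  exact not_NU2_of_ND_eq_none h _ (NU2.ruleB 1 le_rfl B hB)

/-- The pairs with the initial 0 cancel the weights on [-1, 2], except that a 2 has weight 2 and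
only one such pair. -/
theorem deficit_eq_of_neg_one_le {A : List ℤ} (hr : ∀ x ∈ A, -1 ≤ x ∧ x ≤ 2) :
    deficit (0 :: A) = badPairs A - (A.map (ind 2)).sum := by
  have h : (A.map fun x => nd 0 x + ind 2 x).sum = (A.map wt).sum := by
    apply sum_map_eq_of_forall
    intro x hx
    have := hr x hx
    obtain rfl | rfl | rfl | rfl : x = -1 ∨ x = 0 ∨ x = 1 ∨ x = 2 := by omega
    all_goals rfl
  rw [List.sum_map_add] at h
  simp only [deficit, badPairs, List.map_cons, List.sum_cons]
  have : wt 0 = 0 := rfl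
  omega

/-- Two initial zeros give each letter 1 or 2 two bad pairs, which exceeds the weight by 1 for the
letter 1 only. -/
theorem deficit_eq_of_nonneg {A : List ℤ} (hr : ∀ x ∈ A, 0 ≤ x ∧ x ≤ 2) :
    deficit (0 :: 0 :: A) = badPairs A + (A.map (ind 1)).sum := by
  have h : (A.map fun x => nd 0 x + nd 0 x).sum = (A.map fun x => wt x + ind 1 x).sum := by
    apply sum_map_eq_of_forall
    intro x hx
    have := hr x hx
    obtain rfl | rfl | rfl : x = 0 ∨ x = 1 ∨ x = 2 := by omega
    all_goals rfl
  rw [List.sum_map_add, List.sum_map_add] at h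
  simp only [deficit, badPairs, List.map_cons, List.sum_cons]
  have : wt 0 = 0 := rfl
  have : nd 0 0 = 0 := rfl
  omega

/-- A balanced class that `ND` does not move is the class of a flag word if its deficit is small
compared with its minimum triangle height. -/
theorem exists_flagWord_of_deficit_le {c : DyckClass} (hc : c.IsBalanced) (hN : ND c = none)
    (hd : c.deficit + 8 ≤ 2 * c.mind) :
    ∃ (lam : YoungDiagram) (a : ℕ), c = dyckClass _ (isQDV_flagWord0 lam a) ∨
      (1 ≤ a ∧ c = dyckClass _ (isQDV_flagWord1 lam a)) := by
  obtain ⟨A, hA, hb, rfl⟩ := hc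
  have hlast : ∀ x ∈ A.getLast?, 0 < x := by
    intro x hx
    obtain ⟨A, rfl⟩ := List.getLast?_eq_some_iff.1 hx
    by_contra h
    exact not_inC1_of_ND_eq_none hN ((inC1_iff_of_isMinimal hb.isMinimal hA).2 (by omega))
  have hr : ∀ x ∈ A, -1 ≤ x ∧ x ≤ 2 := by
    intro x hx
    refine ⟨?_, (hb.range x hx).2⟩
    rcases List.eq_nil_or_concat' A with rfl | ⟨A, y, rfl⟩
    · simp at hx
    have hy := hlast y (by simp)
    rcases List.mem_append.1 hx with h | h
    -- The last letter y ≥ 1 satisfies y ≤ x + 2.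
    · have := (List.pairwise_append.1 hb.pair).2.2 x h y (by simp)
      omega
    · simp at h; omega
  have hchain := (isQDV_zero_cons.1 hA).2
  rw [deficit_dyckClass] at hd
  by_cases hm : -1 ∈ A
  · rcases badPairs_bound_of_neg_one_mem hr hb.isMinimal hchain hlast hm with ⟨B, rfl⟩ | h
    · exact absurd hN (not_ND_eq_none_of_ruleB (fun x hx => hr x (by simp [hx])) hA)
    -- One shift makes all letters nonnegative, so mind ≤ |A| + 2, whereas the deficit is at least
    -- 2|A| - 3.
    · rw [deficit_eq_of_neg_one_le hr, dyckClass_shift hA] at hd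
      have := mind_le_of_nonneg hA.shift (by
        intro x hx
        simp only [List.mem_cons, List.map_cons, List.mem_map] at hx
        rcases hx with hx | hx | ⟨y, hy, rfl⟩
        · omega
        · omega
        · have := hr y hy; omega)
      simp only [List.length_cons, List.length_map] at this
      omega
  · have hr' : ∀ x ∈ A, 0 ≤ x ∧ x ≤ 2 := by
      intro x hx
      have := hr x hx
      rcases eq_or_ne x (-1) with rfl | hne
      · exact absurd hx hm
      · omega
    have hmind := mind_le_of_nonneg hA (by
      intro x hx
      rcases List.mem_cons.1 hx with hx | hx
      · omega
      · exact (hr' x hx).1)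
    cases A with
    | nil =>
      have : deficit [0] = 0 := rfl
      simp only [List.length_cons, List.length_nil] at hmind
      omega
    | cons z A =>
      obtain rfl : z = 0 := by
        have := hb.isMinimal z (by simp)
        have := hr' z (by simp)
        omega
      have hrA : ∀ x ∈ A, 0 ≤ x ∧ x ≤ 2 := fun x hx => hr' x (by simp [hx])
      rw [List.isChain_cons] at hchain
      have hne : A ≠ [] := by
        rintro rfl
        have := hlast 0 (by simp)
        omega
      have hlastA : ∀ x ∈ A.getLast?, 0 < x := fun x hx =>
        hlast x (by rw [List.getLast?_cons, hx]; rfl)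
      rcases badPairs_bound_of_nonneg hrA (fun x hx => by have := hchain.1 x hx; omega) hchain.2
        hlastA with h | ⟨P, rfl⟩ | ⟨P, rfl, hP⟩ | h
      · cases A with
        | nil => exact absurd rfl hne
        | cons y w =>
          obtain rfl : y = 1 := by
            have := hchain.1 y (by simp)
            have := h y (by simp)
            omega
          obtain ⟨lam, a, e | ⟨ha, e⟩⟩ := exists_flagWord (fun x hx => by
            have := h x (by simp [hx])
            have := hrA x (by simp [hx])
            omega) hA (not_NU2_of_ND_eq_none hN)
          · exact ⟨lam, a, Or.inl (by simp only [e])⟩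
          · exact ⟨lam, a, Or.inr ⟨ha, by simp only [e]⟩⟩
      · exact absurd hN (not_ND_eq_none_of_ruleB (fun x hx => hr x (by simp [hx])) hA)
      · exfalso
        refine not_NU2_of_ND_eq_none hN _ (NU2.ruleA 2 le_rfl P ⟨fun x hx => ?_, hP, ?_⟩)
        · exact (hrA x (by simp [hx])).2
        · have := hchain.2
          rw [List.isChain_cons, List.isChain_append] at this
          exact this.2.1
      · rw [deficit_eq_of_nonneg hrA] at hd
        simp only [List.length_cons] at hmind
        omega

/-- All parts but the first sum to at least ℓ - 1. The bound serves to rule out a = 0 in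
`flagWord1`. -/
theorem one_le_a0 (lam : YoungDiagram) : 1 ≤ a0 lam := by
  have h1 := card_eq_sum_rowLens lam
  have h2 := lam.length_rowLens
  have h3 : ∀ l : List ℕ, (∀ x ∈ l, 0 < x) → l.length ≤ l.sum := fun l hl => by
    simpa using List.card_nsmul_le_sum l 1 hl
  have h4 : ∀ x ∈ lam.rowLens, 0 < x := fun x hx => (mem_rowLens_range hx).1
  have h5 := rowLen_eq_zero_iff lam 0
  have hget : ∀ (h : 0 < lam.rowLens.length), lam.rowLens[0] = lam.rowLen 0 :=
    fun h => YoungDiagram.get_rowLens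
  unfold a0
  cases hl : lam.rowLens with
  | nil =>
    simp only [hl, List.length_nil] at h2
    have := h5.2 (by omega)
    omega
  | cons r l =>
    simp only [hl, List.length_cons, List.getElem_cons_zero, List.sum_cons] at h1 h2 hget h4
    have := hget (by omega)
    have := h3 l fun x hx => h4 x (by simp [hx])
    omega

theorem card_eq_deficit_TI2 (mu : YoungDiagram) : (mu.card : ℤ) = (TI2 mu).deficit := by
  rw [(TI2_properties mu).1.2, deficit_TI]

end Flagpole

/-! ### Proof of the main theorem -/

theorem mainTheorem7 (mu : YoungDiagram) :
    Flagpole.IsFlagpole mu ↔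
      ∃ (lam : YoungDiagram) (a : ℕ), Flagpole.a0 lam ≤ (a : ℤ) ∧
        (Flagpole.TI2 mu =
            Flagpole.dyckClass (Flagpole.flagWord0 lam a) (Flagpole.isQDV_flagWord0 lam a) ∨
          Flagpole.TI2 mu =
            Flagpole.dyckClass (Flagpole.flagWord1 lam a) (Flagpole.isQDV_flagWord1 lam a)) := by
  open Flagpole in
  have hcard := card_eq_deficit_TI2 mu
  -- For the class of a flag word, deficit + 8 ≤ 2 mind rearranges to a_0(lam) ≤ a; this also
  -- discards the too small values of a allowed by `exists_flagWord_of_deficit_le`.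
  have key0 : ∀ (lam : YoungDiagram) (a : ℕ), TI2 mu = dyckClass _ (isQDV_flagWord0 lam a) →
      (IsFlagpole mu ↔ a0 lam ≤ (a : ℤ)) := by
    intro lam a h
    rw [h, deficit_dyckClass, deficit_flagWord0] at hcard
    rw [IsFlagpole, h, mind_flagWord0, a0]
    omega
  have key1 : ∀ (lam : YoungDiagram) (a : ℕ), 1 ≤ a →
      TI2 mu = dyckClass _ (isQDV_flagWord1 lam a) → (IsFlagpole mu ↔ a0 lam ≤ (a : ℤ)) := by
    intro lam a ha h
    rw [h, deficit_dyckClass, deficit_flagWord1 lam ha] at hcard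
    rw [IsFlagpole, h, mind_flagWord1 lam ha, a0]
    omega
  constructor
  · intro hf
    obtain ⟨⟨hb, -⟩, hN⟩ := TI2_properties mu
    have hd : (TI2 mu).deficit + 8 ≤ 2 * (TI2 mu).mind := by
      rw [← hcard]
      exact_mod_cast hf
    obtain ⟨lam, a, h | ⟨ha, h⟩⟩ := exists_flagWord_of_deficit_le hb hN hd
    · exact ⟨lam, a, (key0 lam a h).1 hf, Or.inl h⟩
    · exact ⟨lam, a, (key1 lam a ha h).1 hf, Or.inr h⟩
  · rintro ⟨lam, a, ha, h | h⟩
    · exact (key0 lam a h).2 ha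
    · have := one_le_a0 lam
      exact (key1 lam a (by omega) h).2 ha
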